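/- Let $\mathcal N$ be a smooth $\mathfrak n$-dimensional manifold without boundary, $\gamma$ a smooth symmetric $2$-covariant tensor, $\boldsymbol\ell$ a smooth covector field and $\ell^{(2)}$ a smooth function on $\mathcal N$. Assume that $\{\mathcal N,\gamma,\boldsymbol\ell,\ell^{(2)}\}$ is metric hypersurface data, i.e. that at every $p\in\mathcal N$ the symmetric bilinear form $$\mathcal A\big((W,a),(Z,b)\big)=\gamma(W,Z)+a\,\boldsymbol\ell(Z)+b\,\boldsymbol\ell(W)+ab\,\ell^{(2)}$$ on $T_p\mathcal N\times\mathbb R$ is non-degenerate. Define the symmetric $2$-contravariant tensor $P$, the vector field $n$ and the function $n^{(2)}$ by splitting the inverse of $\mathcal A$ as $P(\boldsymbol\alpha,\boldsymbol\beta)+a\,\boldsymbol\beta(n)+b\,\boldsymbol\alpha(n)+ab\,n^{(2)}$ on $\big((\boldsymbol\alpha,a),(\boldsymbol\beta,b)\big)$, and set $$\mathbf F=\tfrac12 d\boldsymbol\ell,\qquad \boldsymbol s=\mathbf F(n,\cdot),\qquad \mathbf U=\tfrac12\pounds_n\gamma+\tfrac12\big(\boldsymbol\ell\otimes dn^{(2)}+dn^{(2)}\otimes\boldsymbol\ell\big).$$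 Let $\mathring\nabla$ be the metric hypersurface connection, i.e. the torsion-free connection on $\mathcal N$ determined by $$(\mathring\nabla_X\gamma)(Z,W)=-\mathbf U(X,Z)\boldsymbol\ell(W)-\mathbf U(X,W)\boldsymbol\ell(Z),\qquad (\mathring\nabla_X\boldsymbol\ell)(Z)+(\mathring\nabla_Z\boldsymbol\ell)(X)=-2\ell^{(2)}\mathbf U(X,Z),$$ and let $\mathring R^d{}_{bca}$ be its curvature tensor, with $\mathring R^d{}_{bca}\alpha_dZ^bX^cW^a=\boldsymbol\alpha\big((\mathring\nabla_X\mathring\nabla_W-\mathring\nabla_W\mathring\nabla_X-\mathring\nabla_{[X,W]})Z\big)$. Then $$\begin{aligned} \mathring R^d{}_{bca}n^c={}& n^d\Big[\mathring\nabla_b s_a-s_as_b+n^{(2)}\big(s_b\mathring\nabla_a\ell^{(2)}+s_a\mathring\nabla_b\ell^{(2)}\big)+n(\ell^{(2)})\,\mathrm U_{ba}+P^{cf}\mathrm F_{af}\big(\mathrm U_{bc}-n^{(2)}\mathrm F_{bc}\big)\\ &\qquad-\tfrac12\mathring\nabla_b n^{(2)}\mathring\nabla_a\ell^{(2)}-\tfrac12(n^{(2)})^2\mathring\nabla_b\ell^{(2)}\mathring\nabla_a\ell^{(2)}\Big]\\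 &+P^{dc}\Big[\mathring\nabla_b\mathrm U_{ca}-\mathring\nabla_c\mathrm U_{ba}+2s_c\mathrm U_{ba}-s_b\mathrm U_{ac}+\tfrac12\mathrm F_{ca}\mathring\nabla_b n^{(2)}\\ &\qquad+n^{(2)}\Big(-\mathrm U_{ba}\mathring\nabla_c\ell^{(2)}+\mathrm U_{ac}\mathring\nabla_b\ell^{(2)}-\mathring\nabla_a\mathrm F_{cb}+\mathrm F_{ac}\big(s_b-\tfrac12 n^{(2)}\mathring\nabla_b\ell^{(2)}\big)\Big)\Big]. \end{aligned}$$ -/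

import Mathlib

open Bundle
open scoped Manifold ContDiff

noncomputable section

/-! ### Smooth tensor fields, derivatives of tensor fields, curvature

Manifolds of dimension `𝔫` without boundary are modelled on `EuclideanSpace ℝ (Fin 𝔫)`. -/

section Fields

variable {𝔫 : ℕ} {N : Type*} [TopologicalSpace N] [ChartedSpace (EuclideanSpace ℝ (Fin 𝔫)) N]

/-- The differential `df` of a function, `dScalar f x v = v(f)`. -/
def dScalar (f : N → ℝ) (x : N) : TangentSpace (𝓡 𝔫) x →L[ℝ] ℝ := mvfderiv (𝓡 𝔫) f x

/-- `X(θ(Y)) - Y(θ(X)) - θ([X,Y])` at `x`. -/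
def extDerivFields (θ : Π x : N, TangentSpace (𝓡 𝔫) x →L[ℝ] ℝ)
    (X Y : Π x : N, TangentSpace (𝓡 𝔫) x) (x : N) : ℝ :=
  dScalar (fun y => θ y (Y y)) x (X x) - dScalar (fun y => θ y (X y)) x (Y x)
    - θ x (VectorField.mlieBracket (𝓡 𝔫) X Y x)

/-- `V(T(X,Y)) - T([V,X],Y) - T(X,[V,Y])` at `x`. -/
def lieDerivFields (V : Π x : N, TangentSpace (𝓡 𝔫) x)
    (T : Π x : N, TangentSpace (𝓡 𝔫) x →L[ℝ] TangentSpace (𝓡 𝔫) x →L[ℝ] ℝ)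
    (X Y : Π x : N, TangentSpace (𝓡 𝔫) x) (x : N) : ℝ :=
  dScalar (fun y => T y (X y) (Y y)) x (V x)
    - T x (VectorField.mlieBracket (𝓡 𝔫) V X x) (Y x)
    - T x (X x) (VectorField.mlieBracket (𝓡 𝔫) V Y x)

theorem extDerivFields_swap (θ : Π x : N, TangentSpace (𝓡 𝔫) x →L[ℝ] ℝ)
    (X Y : Π x : N, TangentSpace (𝓡 𝔫) x) (x : N) :
    extDerivFields θ X Y x = - extDerivFields θ Y X x := by
  simp only [extDerivFields]
  rw [VectorField.mlieBracket_swap, Pi.neg_apply, map_neg]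
  ring

variable [IsManifold (𝓡 𝔫) ∞ N]

/-- `X` is a smooth vector field, `X ∈ Γ(TN)`. -/
def SmoothVectorField (X : Π x : N, TangentSpace (𝓡 𝔫) x) : Prop :=
  ContMDiff (𝓡 𝔫) ((𝓡 𝔫).prod 𝓘(ℝ, EuclideanSpace ℝ (Fin 𝔫))) ∞
    (fun x => TotalSpace.mk' (EuclideanSpace ℝ (Fin 𝔫)) x (X x))

/-- The vector field `X` is differentiable at `x`. -/
abbrev DifferentiableFieldAt (X : Π x : N, TangentSpace (𝓡 𝔫) x) (x : N) : Prop :=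
  MDifferentiableAt (𝓡 𝔫) ((𝓡 𝔫).prod 𝓘(ℝ, EuclideanSpace ℝ (Fin 𝔫)))
    (fun x => TotalSpace.mk' (EuclideanSpace ℝ (Fin 𝔫)) x (X x)) x

/-- `θ` is a smooth covector field, `θ ∈ Γ(T*N)`. -/
def SmoothCovectorField (θ : Π x : N, TangentSpace (𝓡 𝔫) x →L[ℝ] ℝ) : Prop :=
  ContMDiff (𝓡 𝔫) ((𝓡 𝔫).prod 𝓘(ℝ, EuclideanSpace ℝ (Fin 𝔫) →L[ℝ] ℝ)) ∞
    (fun x => TotalSpace.mk' (EuclideanSpace ℝ (Fin 𝔫) →L[ℝ] ℝ)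
      (E := fun y : N => TangentSpace (𝓡 𝔫) y →L[ℝ] ℝ) x (θ x))

/-- `T` is a smooth `2`-covariant tensor field. -/
def SmoothTwoTensorField
    (T : Π x : N, TangentSpace (𝓡 𝔫) x →L[ℝ] TangentSpace (𝓡 𝔫) x →L[ℝ] ℝ) : Prop :=
  ContMDiff (𝓡 𝔫) ((𝓡 𝔫).prod
      𝓘(ℝ, EuclideanSpace ℝ (Fin 𝔫) →L[ℝ] EuclideanSpace ℝ (Fin 𝔫) →L[ℝ] ℝ)) ∞
    (fun x => TotalSpace.mk' (EuclideanSpace ℝ (Fin 𝔫) →L[ℝ] EuclideanSpace ℝ (Fin 𝔫) →L[ℝ] ℝ)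
      (E := fun y : N => TangentSpace (𝓡 𝔫) y →L[ℝ] TangentSpace (𝓡 𝔫) y →L[ℝ] ℝ) x (T x))

theorem SmoothCovectorField.mdifferentiableAt_apply
    {θ : Π x : N, TangentSpace (𝓡 𝔫) x →L[ℝ] ℝ} (hθ : SmoothCovectorField θ)
    {X : Π x : N, TangentSpace (𝓡 𝔫) x} {x : N} (hX : DifferentiableFieldAt X x) :
    MDifferentiableAt (𝓡 𝔫) 𝓘(ℝ, ℝ) (fun y => θ y (X y)) x := by
  have h : MDifferentiableAt (𝓡 𝔫) ((𝓡 𝔫).prod 𝓘(ℝ, ℝ))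
      (fun m ↦ TotalSpace.mk' ℝ (E := Bundle.Trivial N ℝ) m (θ m (X m))) x := by
    apply MDifferentiableAt.clm_bundle_apply (F₁ := EuclideanSpace ℝ (Fin 𝔫))
    · exact (hθ x).mdifferentiableAt (by simp)
    · exact hX
  simp only [mdifferentiableAt_totalSpace] at h
  exact h.2

theorem SmoothTwoTensorField.mdifferentiableAt_apply
    {T : Π x : N, TangentSpace (𝓡 𝔫) x →L[ℝ] TangentSpace (𝓡 𝔫) x →L[ℝ] ℝ}
    (hT : SmoothTwoTensorField T) {X Y : Π x : N, TangentSpace (𝓡 𝔫) x} {x : N}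
    (hX : DifferentiableFieldAt X x) (hY : DifferentiableFieldAt Y x) :
    MDifferentiableAt (𝓡 𝔫) 𝓘(ℝ, ℝ) (fun y => T y (X y) (Y y)) x := by
  have h : MDifferentiableAt (𝓡 𝔫) ((𝓡 𝔫).prod 𝓘(ℝ, ℝ))
      (fun m ↦ TotalSpace.mk' ℝ (E := Bundle.Trivial N ℝ) m (T m (X m) (Y m))) x := by
    apply MDifferentiableAt.clm_bundle_apply₂ (F₁ := EuclideanSpace ℝ (Fin 𝔫))
      (F₂ := EuclideanSpace ℝ (Fin 𝔫))
    · exact (hT x).mdifferentiableAt (by simp)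
    · exact hX
    · exact hY
  simp only [mdifferentiableAt_totalSpace] at h
  exact h.2

theorem tensorialAt_extDerivFields {θ : Π x : N, TangentSpace (𝓡 𝔫) x →L[ℝ] ℝ}
    (hθ : SmoothCovectorField θ) (x : N) {Y : Π x : N, TangentSpace (𝓡 𝔫) x} :
    TensorialAt (𝓡 𝔫) (EuclideanSpace ℝ (Fin 𝔫)) (fun X => extDerivFields θ X Y x) x where
  smul {f X} hf hX := by
    have h1 : dScalar (fun y => f y * θ y (X y)) x
        = f x • dScalar (fun y => θ y (X y)) x + θ x (X x) • dScalar f x :=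
      mvfderiv_fun_mul hf (hθ.mdifferentiableAt_apply hX)
    simp only [extDerivFields, Pi.smul_apply', map_smul, smul_eq_mul, h1,
      VectorField.mlieBracket_smul_left hf hX]
    simp [dScalar]
    ring
  add {X X'} hX hX' := by
    have h1 : dScalar (fun y => θ y (X y) + θ y (X' y)) x
        = dScalar (fun y => θ y (X y)) x + dScalar (fun y => θ y (X' y)) x :=
      mvfderiv_fun_add (hθ.mdifferentiableAt_apply hX) (hθ.mdifferentiableAt_apply hX')
    simp only [extDerivFields, Pi.add_apply, map_add, h1, VectorField.mlieBracket_add_left hX hX']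
    simp
    ring

/-- The exterior derivative `dθ` of a smooth one-form, as a tensor field:
`dθ(X,Y) = X(θ(Y)) - Y(θ(X)) - θ([X,Y])`. -/
def extDerivOneForm (θ : Π x : N, TangentSpace (𝓡 𝔫) x →L[ℝ] ℝ) (hθ : SmoothCovectorField θ)
    (x : N) : TangentSpace (𝓡 𝔫) x →L[ℝ] TangentSpace (𝓡 𝔫) x →L[ℝ] ℝ :=
  TensorialAt.mkHom₂ (I := 𝓡 𝔫) (F := EuclideanSpace ℝ (Fin 𝔫))
    (F' := EuclideanSpace ℝ (Fin 𝔫)) (fun X Y => extDerivFields θ X Y x) x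
    (fun _ _ => tensorialAt_extDerivFields hθ x)
    (fun X _ => by
      have h := tensorialAt_extDerivFields hθ x (Y := X)
      refine ⟨fun {f Y} hf hY => ?_, fun {Y Y'} hY hY' => ?_⟩
      · have := h.smul hf hY
        simp only [extDerivFields_swap θ X, this, smul_neg]
      · have := h.add hY hY'
        simp only [extDerivFields_swap θ X, this, neg_add])

theorem extDerivOneForm_apply {θ : Π x : N, TangentSpace (𝓡 𝔫) x →L[ℝ] ℝ}
    (hθ : SmoothCovectorField θ) {x : N} {X Y : Π x : N, TangentSpace (𝓡 𝔫) x}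
    (hX : DifferentiableFieldAt X x) (hY : DifferentiableFieldAt Y x) :
    extDerivOneForm θ hθ x (X x) (Y x) =
      dScalar (fun y => θ y (Y y)) x (X x) - dScalar (fun y => θ y (X y)) x (Y x)
        - θ x (VectorField.mlieBracket (𝓡 𝔫) X Y x) :=
  TensorialAt.mkHom₂_apply _ _ hX hY

theorem tensorialAt_lieDerivFields_left (V : Π x : N, TangentSpace (𝓡 𝔫) x)
    {T : Π x : N, TangentSpace (𝓡 𝔫) x →L[ℝ] TangentSpace (𝓡 𝔫) x →L[ℝ] ℝ}
    (hT : SmoothTwoTensorField T) (x : N) {Y : Π x : N, TangentSpace (𝓡 𝔫) x}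
    (hY : DifferentiableFieldAt Y x) :
    TensorialAt (𝓡 𝔫) (EuclideanSpace ℝ (Fin 𝔫)) (fun X => lieDerivFields V T X Y x) x where
  smul {f X} hf hX := by
    have h1 : dScalar (fun y => f y * T y (X y) (Y y)) x
        = f x • dScalar (fun y => T y (X y) (Y y)) x + T x (X x) (Y x) • dScalar f x :=
      mvfderiv_fun_mul hf (hT.mdifferentiableAt_apply hX hY)
    simp only [lieDerivFields, Pi.smul_apply', map_smul, smul_eq_mul, smul_apply,
      h1, VectorField.mlieBracket_smul_right hf hX]
    simp [dScalar]
    ring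
  add {X X'} hX hX' := by
    have h1 : dScalar (fun y => T y (X y) (Y y) + T y (X' y) (Y y)) x
        = dScalar (fun y => T y (X y) (Y y)) x + dScalar (fun y => T y (X' y) (Y y)) x :=
      mvfderiv_fun_add (hT.mdifferentiableAt_apply hX hY) (hT.mdifferentiableAt_apply hX' hY)
    simp only [lieDerivFields, Pi.add_apply, map_add, add_apply, h1,
      VectorField.mlieBracket_add_right hX hX']
    ring

theorem tensorialAt_lieDerivFields_right (V : Π x : N, TangentSpace (𝓡 𝔫) x)
    {T : Π x : N, TangentSpace (𝓡 𝔫) x →L[ℝ] TangentSpace (𝓡 𝔫) x →L[ℝ] ℝ}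
    (hT : SmoothTwoTensorField T) (x : N) {X : Π x : N, TangentSpace (𝓡 𝔫) x}
    (hX : DifferentiableFieldAt X x) :
    TensorialAt (𝓡 𝔫) (EuclideanSpace ℝ (Fin 𝔫)) (fun Y => lieDerivFields V T X Y x) x where
  smul {f Y} hf hY := by
    have h1 : dScalar (fun y => f y * T y (X y) (Y y)) x
        = f x • dScalar (fun y => T y (X y) (Y y)) x + T x (X x) (Y x) • dScalar f x :=
      mvfderiv_fun_mul hf (hT.mdifferentiableAt_apply hX hY)
    simp only [lieDerivFields, Pi.smul_apply', map_smul, smul_eq_mul, h1,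
      VectorField.mlieBracket_smul_right hf hY]
    simp [dScalar]
    ring
  add {Y Y'} hY hY' := by
    have h1 : dScalar (fun y => T y (X y) (Y y) + T y (X y) (Y' y)) x
        = dScalar (fun y => T y (X y) (Y y)) x + dScalar (fun y => T y (X y) (Y' y)) x :=
      mvfderiv_fun_add (hT.mdifferentiableAt_apply hX hY) (hT.mdifferentiableAt_apply hX hY')
    simp only [lieDerivFields, Pi.add_apply, map_add, add_apply, h1,
      VectorField.mlieBracket_add_right hY hY']
    ring

/-- The Lie derivative `£_V T` of a smooth `2`-covariant tensor field, as a tensor field: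
`(£_V T)(X,Y) = V(T(X,Y)) - T([V,X],Y) - T(X,[V,Y])`. -/
def lieDerivTwoTensor (V : Π x : N, TangentSpace (𝓡 𝔫) x)
    (T : Π x : N, TangentSpace (𝓡 𝔫) x →L[ℝ] TangentSpace (𝓡 𝔫) x →L[ℝ] ℝ)
    (hT : SmoothTwoTensorField T) (x : N) :
    TangentSpace (𝓡 𝔫) x →L[ℝ] TangentSpace (𝓡 𝔫) x →L[ℝ] ℝ :=
  TensorialAt.mkHom₂ (I := 𝓡 𝔫) (F := EuclideanSpace ℝ (Fin 𝔫))
    (F' := EuclideanSpace ℝ (Fin 𝔫)) (fun X Y => lieDerivFields V T X Y x) x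
    (fun _ hY => tensorialAt_lieDerivFields_left V hT x hY)
    (fun _ hX => tensorialAt_lieDerivFields_right V hT x hX)

theorem lieDerivTwoTensor_apply (V : Π x : N, TangentSpace (𝓡 𝔫) x)
    {T : Π x : N, TangentSpace (𝓡 𝔫) x →L[ℝ] TangentSpace (𝓡 𝔫) x →L[ℝ] ℝ}
    (hT : SmoothTwoTensorField T) {x : N} {X Y : Π x : N, TangentSpace (𝓡 𝔫) x}
    (hX : DifferentiableFieldAt X x) (hY : DifferentiableFieldAt Y x) :
    lieDerivTwoTensor V T hT x (X x) (Y x) =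
      dScalar (fun y => T y (X y) (Y y)) x (V x)
        - T x (VectorField.mlieBracket (𝓡 𝔫) V X x) (Y x)
        - T x (X x) (VectorField.mlieBracket (𝓡 𝔫) V Y x) :=
  TensorialAt.mkHom₂_apply _ _ hX hY

variable (D : CovariantDerivative (𝓡 𝔫) (EuclideanSpace ℝ (Fin 𝔫))
  (TangentSpace (𝓡 𝔫) : N → Type _))

/-- `∇_X Y` as a vector field. -/
def covField (X Y : Π x : N, TangentSpace (𝓡 𝔫) x) (x : N) : TangentSpace (𝓡 𝔫) x :=
  D Y x (X x)

/-- The covariant derivative of a one-form: `(∇_X θ)(Y) = X(θ(Y)) - θ(∇_X Y)`. -/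
def covOneForm (θ : Π x : N, TangentSpace (𝓡 𝔫) x →L[ℝ] ℝ)
    (X Y : Π x : N, TangentSpace (𝓡 𝔫) x) (x : N) : ℝ :=
  dScalar (fun y => θ y (Y y)) x (X x) - θ x (covField D X Y x)

/-- The covariant derivative of a `2`-covariant tensor field:
`(∇_X T)(Y,Z) = X(T(Y,Z)) - T(∇_X Y,Z) - T(Y,∇_X Z)`. -/
def covTwoTensor (T : Π x : N, TangentSpace (𝓡 𝔫) x →L[ℝ] TangentSpace (𝓡 𝔫) x →L[ℝ] ℝ)
    (X Y Z : Π x : N, TangentSpace (𝓡 𝔫) x) (x : N) : ℝ :=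
  dScalar (fun y => T y (Y y) (Z y)) x (X x)
    - T x (covField D X Y x) (Z x) - T x (Y x) (covField D X Z x)

/-- The curvature operator `R(X,W)Z = ∇_X ∇_W Z - ∇_W ∇_X Z - ∇_{[X,W]} Z`. -/
def curvatureOp (X W Z : Π x : N, TangentSpace (𝓡 𝔫) x) (x : N) : TangentSpace (𝓡 𝔫) x :=
  covField D X (covField D W Z) x - covField D W (covField D X Z) x
    - covField D (VectorField.mlieBracket (𝓡 𝔫) X W) Z x

/-- The curvature tensor `Riem(α,Z,X,W) = α(R(X,W)Z)`. In index notation this is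
`R^d_{bca} α_d Z^b X^c W^a`. -/
def riem (α : Π x : N, TangentSpace (𝓡 𝔫) x →L[ℝ] ℝ) (Z X W : Π x : N, TangentSpace (𝓡 𝔫) x)
    (x : N) : ℝ :=
  α x (curvatureOp D X W Z x)

end Fields

/-! ### Metric hypersurface data -/

/-- The symmetric bilinear form
`𝓐((W,a),(Z,b)) = γ(W,Z) + a ℓ(Z) + b ℓ(W) + a b ℓ⁽²⁾` on `V × ℝ`. -/
def ambientForm {V : Type*} [AddCommGroup V] [Module ℝ V] [TopologicalSpace V]
    [IsTopologicalAddGroup V] [ContinuousConstSMul ℝ V]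
    (γ : V →L[ℝ] V →L[ℝ] ℝ) (l : V →L[ℝ] ℝ) (l2 : ℝ) : LinearMap.BilinForm ℝ (V × ℝ) :=
  LinearMap.mk₂ ℝ (fun p q => γ p.1 q.1 + p.2 * l q.1 + q.2 * l p.1 + p.2 * q.2 * l2)
    (fun p p' q => by simp; ring) (fun c p q => by simp; ring)
    (fun p q q' => by simp; ring) (fun c p q => by simp; ring)

/-- Metric hypersurface data `{N, γ, ℓ, ℓ⁽²⁾}` on the `𝔫`-dimensional manifold `N`. -/
structure MetricHypersurfaceData (𝔫 : ℕ) (N : Type*) [TopologicalSpace N]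
    [ChartedSpace (EuclideanSpace ℝ (Fin 𝔫)) N] [IsManifold (𝓡 𝔫) ∞ N] where
  γ : Π x : N, TangentSpace (𝓡 𝔫) x →L[ℝ] TangentSpace (𝓡 𝔫) x →L[ℝ] ℝ
  l : Π x : N, TangentSpace (𝓡 𝔫) x →L[ℝ] ℝ
  l2 : N → ℝ
  γ_smooth : SmoothTwoTensorField γ
  γ_symm : ∀ x v w, γ x v w = γ x w v
  l_smooth : SmoothCovectorField l
  l2_smooth : ContMDiff (𝓡 𝔫) 𝓘(ℝ, ℝ) ∞ l2
  nondegenerate : ∀ x, (ambientForm (γ x) (l x) (l2 x)).Nondegenerate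

namespace MetricHypersurfaceData

variable {𝔫 : ℕ} {N : Type*} [TopologicalSpace N] [ChartedSpace (EuclideanSpace ℝ (Fin 𝔫)) N]
  [IsManifold (𝓡 𝔫) ∞ N] (d : MetricHypersurfaceData 𝔫 N)

/-- The isomorphism `T*_x N × ℝ → T_x N × ℝ` induced by the inverse of `𝓐`: the image `q` of
`(β,b)` is determined by `𝓐(q,(Z,c)) = β(Z) + b c`. The inverse tensor of `𝓐` applied to
`(β,b)` and `(α,a)` is therefore `α(q.1) + a q.2`. -/
def ambientSharp (x : N) (ξ : (TangentSpace (𝓡 𝔫) x →L[ℝ] ℝ) × ℝ) : TangentSpace (𝓡 𝔫) x × ℝ :=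
  have : FiniteDimensional ℝ (TangentSpace (𝓡 𝔫) x) :=
    inferInstanceAs (FiniteDimensional ℝ (EuclideanSpace ℝ (Fin 𝔫)))
  (LinearMap.BilinForm.toDual _ (d.nondegenerate x)).symm
    (ξ.1.toLinearMap ∘ₗ LinearMap.fst ℝ _ ℝ + ξ.2 • LinearMap.snd ℝ (TangentSpace (𝓡 𝔫) x) ℝ)

theorem ambientForm_ambientSharp (x : N) (ξ : (TangentSpace (𝓡 𝔫) x →L[ℝ] ℝ) × ℝ)
    (q : TangentSpace (𝓡 𝔫) x × ℝ) :
    ambientForm (d.γ x) (d.l x) (d.l2 x) (d.ambientSharp x ξ) q = ξ.1 q.1 + ξ.2 * q.2 := by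
  have : FiniteDimensional ℝ (TangentSpace (𝓡 𝔫) x) :=
    inferInstanceAs (FiniteDimensional ℝ (EuclideanSpace ℝ (Fin 𝔫)))
  simp only [ambientSharp, LinearMap.BilinForm.apply_toDual_symm_apply]
  simp

/-- The inverse contravariant tensor of `𝓐` on `T*_x N × ℝ`. -/
def ambientInverse (x : N) (ξ η : (TangentSpace (𝓡 𝔫) x →L[ℝ] ℝ) × ℝ) : ℝ :=
  η.1 (d.ambientSharp x ξ).1 + η.2 * (d.ambientSharp x ξ).2

/-- The vector `P(α,·)`, that is `P^{dc} α_c`. -/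
def raise (x : N) (α : TangentSpace (𝓡 𝔫) x →L[ℝ] ℝ) : TangentSpace (𝓡 𝔫) x :=
  (d.ambientSharp x (α, 0)).1

/-- The vector field `P(α,·)` of a covector field `α`. -/
def raiseField (α : Π x : N, TangentSpace (𝓡 𝔫) x →L[ℝ] ℝ) (x : N) : TangentSpace (𝓡 𝔫) x :=
  d.raise x (α x)

/-- The `2`-contravariant tensor `P`. -/
def P (x : N) (α β : TangentSpace (𝓡 𝔫) x →L[ℝ] ℝ) : ℝ := β (d.raise x α)

/-- The vector field `n`. -/
def n (x : N) : TangentSpace (𝓡 𝔫) x := (d.ambientSharp x (0, 1)).1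

/-- The function `n⁽²⁾`. -/
def n2 (x : N) : ℝ := (d.ambientSharp x (0, 1)).2

/-- `F = (1/2) dℓ`. -/
def F (x : N) : TangentSpace (𝓡 𝔫) x →L[ℝ] TangentSpace (𝓡 𝔫) x →L[ℝ] ℝ :=
  (1 / 2 : ℝ) • extDerivOneForm d.l d.l_smooth x

/-- `s = F(n,·)`. -/
def s (x : N) : TangentSpace (𝓡 𝔫) x →L[ℝ] ℝ := d.F x (d.n x)

/-- `U = (1/2) £_n γ + ℓ ⊗_s dn⁽²⁾`, with `A ⊗_s B = (1/2)(A ⊗ B + B ⊗ A)`. -/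
def U (x : N) : TangentSpace (𝓡 𝔫) x →L[ℝ] TangentSpace (𝓡 𝔫) x →L[ℝ] ℝ :=
  (1 / 2 : ℝ) • lieDerivTwoTensor d.n d.γ d.γ_smooth x
    + (1 / 2 : ℝ) • ((d.l x).smulRight (dScalar d.n2 x) + (dScalar d.n2 x).smulRight (d.l x))

/-- The splitting of the inverse tensor of `𝓐` that characterizes `P`, `n` and `n⁽²⁾`. -/
theorem ambientInverse_eq (x : N) (α β : TangentSpace (𝓡 𝔫) x →L[ℝ] ℝ) (a b : ℝ) :
    d.ambientInverse x (α, a) (β, b) =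
      d.P x α β + a * β (d.n x) + b * α (d.n x) + a * b * d.n2 x := by
  have h1 : d.ambientSharp x (α, a) = d.ambientSharp x (α, 0) + a • d.ambientSharp x (0, 1) := by
    rw [← sub_eq_zero]
    refine (d.nondegenerate x).1 _ fun q => ?_
    rw [map_sub, map_add, map_smul, LinearMap.sub_apply, LinearMap.add_apply, LinearMap.smul_apply]
    simp only [ambientForm_ambientSharp]
    simp
  have h2 : (d.ambientSharp x (α, 0)).2 = α (d.n x) := by
    have e1 := d.ambientForm_ambientSharp x (α, 0) (d.ambientSharp x (0, 1))
    have e2 := d.ambientForm_ambientSharp x (0, 1) (d.ambientSharp x (α, 0))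
    have e3 : ambientForm (d.γ x) (d.l x) (d.l2 x) (d.ambientSharp x (α, 0))
        (d.ambientSharp x (0, 1)) = ambientForm (d.γ x) (d.l x) (d.l2 x) (d.ambientSharp x (0, 1))
        (d.ambientSharp x (α, 0)) := by
      simp only [ambientForm, LinearMap.mk₂_apply, d.γ_symm x (d.ambientSharp x (α, 0)).1]
      ring
    rw [e1, e2] at e3
    simpa [n] using e3.symm
  simp only [ambientInverse, h1, P, raise, n, n2, Prod.fst_add, Prod.snd_add, Prod.smul_fst,
    Prod.smul_snd, map_add, map_smul, smul_eq_mul, h2]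
  ring

/-- `D` is the metric hypersurface connection of the data: the smooth torsion-free connection
on `N` with, for all smooth vector fields `X`, `Z`, `W`,
`(∇_X γ)(Z,W) = -U(X,Z) ℓ(W) - U(X,W) ℓ(Z)` and
`(∇_X ℓ)(Z) + (∇_Z ℓ)(X) = -2 ℓ⁽²⁾ U(X,Z)`. -/
structure IsMetricHypersurfaceConnection
    (D : CovariantDerivative (𝓡 𝔫) (EuclideanSpace ℝ (Fin 𝔫))
      (TangentSpace (𝓡 𝔫) : N → Type _)) : Prop where
  smooth : D.ContMDiffCovariantDerivative ∞
  torsion_eq_zero : D.torsion = 0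
  cov_γ : ∀ X Z W : Π x : N, TangentSpace (𝓡 𝔫) x,
    SmoothVectorField X → SmoothVectorField Z → SmoothVectorField W → ∀ x,
      covTwoTensor D d.γ X Z W x =
        - d.U x (X x) (Z x) * d.l x (W x) - d.U x (X x) (W x) * d.l x (Z x)
  cov_l : ∀ X Z : Π x : N, TangentSpace (𝓡 𝔫) x,
    SmoothVectorField X → SmoothVectorField Z → ∀ x,
      covOneForm D d.l X Z x + covOneForm D d.l Z X x = - 2 * d.l2 x * d.U x (X x) (Z x)

end MetricHypersurfaceData

end

set_option linter.unusedSectionVars false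

noncomputable section

/-! ### Smooth fields, directional derivatives and Lie brackets -/

section SmoothFields

variable {𝔫 : ℕ} {N : Type*} [TopologicalSpace N] [ChartedSpace (EuclideanSpace ℝ (Fin 𝔫)) N]
  [IsManifold (𝓡 𝔫) ∞ N]

/-! Put `V = P(α,·)`. Since `P`, `n`, `n⁽²⁾` come from the inverse of `𝓐`, every covector splits as
`α = γ(V,·) + α(n) ℓ`, with `ℓ(V) = -α(n) ℓ⁽²⁾`. So `α(R(n,X)W)` is `γ(R(n,X)W, V)` plus `α(n)`
times `ℓ(R(n,X)W)`.

The `ℓ` part is a Ricci identity: the connection satisfies `∇ℓ = F - ℓ⁽²⁾ U`, and antisymmetrising a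
further derivative gives `ℓ(R(X,Y)Z)` (`l_curvatureOp`).

For the `γ` part, `∇γ` is not zero, so `γ(R(·,·)·,·)` is not antisymmetric in its last pair. The
Ricci identity for `γ` computes the defect (`γ_curvatureOp_add`), and the first Bianchi identity
converts these defects into a defect of pair symmetry (`γ_curvatureOp_pair`). Hence `γ(R(n,X)W, V)`
is exchanged for `γ(R(W,V)n, X)`, then, up to another defect, for `-γ(R(W,V)X, n)`. As `γ(n,·) =
-n⁽²⁾ ℓ`, this is once more the Ricci identity for `ℓ`.

What remains are covariant derivatives of `F` and `U`, some with `n` in a slot. They are expanded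
using `s = F(n,·)`, the value of `U(n,·)` (`U_n`) and that of `∇n` (`covField_n`). Closedness of `F`
and symmetry of Hessians then reduce the claim to polynomial algebra (`γ_curvatureOp_n`). -/

theorem SmoothVectorField.differentiableFieldAt {X : Π x : N, TangentSpace (𝓡 𝔫) x}
    (hX : SmoothVectorField X) (x : N) : DifferentiableFieldAt X x :=
  (hX x).mdifferentiableAt (by simp)

/-- Reduces pointwise tensor identities to global smooth fields: a local extension of the vector is
cut off by a bump function. The Hausdorff hypothesis enters the whole argument only through this
lemma. -/
theorem exists_smoothVectorField_eq [T2Space N] (x : N) (v : TangentSpace (𝓡 𝔫) x) :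
    ∃ Z : Π x : N, TangentSpace (𝓡 𝔫) x, SmoothVectorField Z ∧ Z x = v := by
  obtain ⟨t, ht, hZ⟩ := FiberBundle.exists_contMDiffOn_extend (k := ∞) (𝓡 𝔫) (EuclideanSpace ℝ (Fin 𝔫)) v
  obtain ⟨t', ht', ho, hx⟩ := mem_nhds_iff.1 ht
  obtain ⟨f, -, hf⟩ := (SmoothBumpFunction.nhds_basis_tsupport (I := 𝓡 𝔫) x).mem_iff.1
    (ho.mem_nhds hx)
  refine ⟨fun y => f y • FiberBundle.extend (EuclideanSpace ℝ (Fin 𝔫)) v y, ?_, by simp⟩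
  exact ContMDiffOn.smul_section_of_tsupport (f.contMDiff.contMDiffOn) ho hf (hZ.mono ht')

theorem SmoothCovectorField.apply {θ : Π x : N, TangentSpace (𝓡 𝔫) x →L[ℝ] ℝ}
    (hθ : SmoothCovectorField θ) {X : Π x : N, TangentSpace (𝓡 𝔫) x} (hX : SmoothVectorField X) :
    ContMDiff (𝓡 𝔫) 𝓘(ℝ, ℝ) ∞ (fun y => θ y (X y)) := by
  intro x
  have h : ContMDiffAt (𝓡 𝔫) ((𝓡 𝔫).prod 𝓘(ℝ, ℝ)) ∞
      (fun m ↦ TotalSpace.mk' ℝ (E := Bundle.Trivial N ℝ) m (θ m (X m))) x :=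
    ContMDiffAt.clm_bundle_apply (F₁ := EuclideanSpace ℝ (Fin 𝔫)) (hθ x) (hX x)
  rw [contMDiffAt_totalSpace] at h
  exact h.2

theorem SmoothTwoTensorField.apply
    {T : Π x : N, TangentSpace (𝓡 𝔫) x →L[ℝ] TangentSpace (𝓡 𝔫) x →L[ℝ] ℝ}
    (hT : SmoothTwoTensorField T) {X Y : Π x : N, TangentSpace (𝓡 𝔫) x}
    (hX : SmoothVectorField X) (hY : SmoothVectorField Y) :
    ContMDiff (𝓡 𝔫) 𝓘(ℝ, ℝ) ∞ (fun y => T y (X y) (Y y)) := by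
  intro x
  have h : ContMDiffAt (𝓡 𝔫) ((𝓡 𝔫).prod 𝓘(ℝ, ℝ)) ∞
      (fun m ↦ TotalSpace.mk' ℝ (E := Bundle.Trivial N ℝ) m (T m (X m) (Y m))) x :=
    ContMDiffAt.clm_bundle_apply₂ (F₁ := EuclideanSpace ℝ (Fin 𝔫))
      (F₂ := EuclideanSpace ℝ (Fin 𝔫)) (hT x) (hX x) (hY x)
  rw [contMDiffAt_totalSpace] at h
  exact h.2

theorem SmoothVectorField.smul {f : N → ℝ} (hf : ContMDiff (𝓡 𝔫) 𝓘(ℝ, ℝ) ∞ f)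
    {X : Π x : N, TangentSpace (𝓡 𝔫) x} (hX : SmoothVectorField X) :
    SmoothVectorField (fun x => f x • X x) :=
  ContMDiff.smul_section hf hX

theorem SmoothVectorField.mlieBracket {X Y : Π x : N, TangentSpace (𝓡 𝔫) x}
    (hX : SmoothVectorField X) (hY : SmoothVectorField Y) :
    SmoothVectorField (VectorField.mlieBracket (𝓡 𝔫) X Y) := by
  intro x
  have : IsManifold (𝓡 𝔫) (((⊤ : ℕ∞) : WithTop ℕ∞) + 1) N :=
    inferInstanceAs (IsManifold (𝓡 𝔫) ∞ N)
  have : IsManifold (𝓡 𝔫) (minSmoothness ℝ 2) N :=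
    .of_le (n := ∞) (by simpa using ENat.LEInfty.out)
  exact ContMDiffAt.mlieBracket_vectorField (n := ⊤) (m := ⊤) (hX x) (hY x)
    (by simp [minSmoothness_of_isRCLikeNormedField])

theorem contMDiff_dScalar_apply {f : N → ℝ} (hf : ContMDiff (𝓡 𝔫) 𝓘(ℝ, ℝ) ∞ f)
    {X : Π x : N, TangentSpace (𝓡 𝔫) x} (hX : SmoothVectorField X) :
    ContMDiff (𝓡 𝔫) 𝓘(ℝ, ℝ) ∞ (fun y => dScalar f y (X y)) := by
  have : IsManifold (𝓡 𝔫) 1 N := .of_le (n := ∞) (by simp)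
  intro x
  have h : ContMDiffAt (𝓡 𝔫) 𝓘(ℝ, ℝ).tangent ∞
      (fun y => tangentMap (𝓡 𝔫) 𝓘(ℝ, ℝ) f ⟨y, X y⟩) x :=
    ((hf.contMDiff_tangentMap (m := ∞) (by simp)).comp hX) x
  have h2 := (contMDiffAt_totalSpace.1 h).2
  refine h2.congr_of_eventuallyEq (.of_forall fun y => ?_)
  simp [tangentMap, trivializationAt_model_space_apply, dScalar, mvfderiv]
  rfl

theorem SmoothVectorField.covField {D : CovariantDerivative (𝓡 𝔫) (EuclideanSpace ℝ (Fin 𝔫))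
      (TangentSpace (𝓡 𝔫) : N → Type _)} (hD : D.ContMDiffCovariantDerivative ∞)
    {X Y : Π x : N, TangentSpace (𝓡 𝔫) x}
    (hX : SmoothVectorField X) (hY : SmoothVectorField Y) :
    SmoothVectorField (covField D X Y) := by
  intro x
  have h := hD.contMDiff.contMDiff (σ := Y) (by simpa using (ContMDiff.contMDiffOn hY))
  exact ContMDiffAt.clm_bundle_apply (F₁ := EuclideanSpace ℝ (Fin 𝔫))
    (F₂ := EuclideanSpace ℝ (Fin 𝔫)) ((contMDiffOn_univ.1 h) x) (hX x)

theorem dScalar_add_apply {f g : N → ℝ} (hf : ContMDiff (𝓡 𝔫) 𝓘(ℝ, ℝ) ∞ f)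
    (hg : ContMDiff (𝓡 𝔫) 𝓘(ℝ, ℝ) ∞ g) (x : N) (v : TangentSpace (𝓡 𝔫) x) :
    dScalar (fun y => f y + g y) x v = dScalar f x v + dScalar g x v := by
  have h : dScalar (𝔫 := 𝔫) (fun y => f y + g y) x = dScalar f x + dScalar g x :=
    mvfderiv_fun_add ((hf x).mdifferentiableAt (by simp)) ((hg x).mdifferentiableAt (by simp))
  rw [h]; rfl

theorem dScalar_sub_apply {f g : N → ℝ} (hf : ContMDiff (𝓡 𝔫) 𝓘(ℝ, ℝ) ∞ f)
    (hg : ContMDiff (𝓡 𝔫) 𝓘(ℝ, ℝ) ∞ g) (x : N) (v : TangentSpace (𝓡 𝔫) x) :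
    dScalar (fun y => f y - g y) x v = dScalar f x v - dScalar g x v := by
  have h : dScalar (𝔫 := 𝔫) (fun y => f y - g y) x = dScalar f x - dScalar g x :=
    mvfderiv_fun_sub ((hf x).mdifferentiableAt (by simp)) ((hg x).mdifferentiableAt (by simp))
  rw [h]; rfl

theorem dScalar_neg_apply (f : N → ℝ) (x : N) (v : TangentSpace (𝓡 𝔫) x) :
    dScalar (fun y => - f y) x v = - dScalar f x v := by
  have h : dScalar (𝔫 := 𝔫) (fun y => - f y) x = - dScalar f x := mvfderiv_fun_neg
  rw [h]; rfl

theorem dScalar_mul_apply {f g : N → ℝ} (hf : ContMDiff (𝓡 𝔫) 𝓘(ℝ, ℝ) ∞ f)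
    (hg : ContMDiff (𝓡 𝔫) 𝓘(ℝ, ℝ) ∞ g) (x : N) (v : TangentSpace (𝓡 𝔫) x) :
    dScalar (fun y => f y * g y) x v = f x * dScalar g x v + g x * dScalar f x v := by
  have h : dScalar (𝔫 := 𝔫) (fun y => f y * g y) x = f x • dScalar g x + g x • dScalar f x :=
    mvfderiv_fun_mul ((hf x).mdifferentiableAt (by simp)) ((hg x).mdifferentiableAt (by simp))
  rw [h]; rfl

theorem dScalar_const_apply (c : ℝ) (x : N) (v : TangentSpace (𝓡 𝔫) x) :
    dScalar (fun _ => c) x v = 0 := by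
  have h : dScalar (𝔫 := 𝔫) (fun _ : N => c) x = 0 := mvfderiv_const c
  rw [h]; rfl

theorem mlieBracket_smul_right_fun {f : N → ℝ} (hf : ContMDiff (𝓡 𝔫) 𝓘(ℝ, ℝ) ∞ f)
    {Y Z : Π x : N, TangentSpace (𝓡 𝔫) x} (hZ : SmoothVectorField Z) :
    VectorField.mlieBracket (𝓡 𝔫) Y (fun y => f y • Z y) =
      fun y => dScalar f y (Y y) • Z y + f y • VectorField.mlieBracket (𝓡 𝔫) Y Z y := by
  funext y
  exact VectorField.mlieBracket_smul_right ((hf y).mdifferentiableAt (by simp))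
    (hZ.differentiableFieldAt y)

theorem mlieBracket_add_right_fun {Y Z W : Π x : N, TangentSpace (𝓡 𝔫) x}
    (hZ : SmoothVectorField Z) (hW : SmoothVectorField W) :
    VectorField.mlieBracket (𝓡 𝔫) Y (fun y => Z y + W y) =
      fun y => VectorField.mlieBracket (𝓡 𝔫) Y Z y + VectorField.mlieBracket (𝓡 𝔫) Y W y := by
  funext y
  exact VectorField.mlieBracket_add_right (hZ.differentiableFieldAt y)
    (hW.differentiableFieldAt y)

theorem mlieBracket_jacobi {X Y Z : Π x : N, TangentSpace (𝓡 𝔫) x}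
    (hX : SmoothVectorField X) (hY : SmoothVectorField Y) (hZ : SmoothVectorField Z) (x : N) :
    VectorField.mlieBracket (𝓡 𝔫) X (VectorField.mlieBracket (𝓡 𝔫) Y Z) x =
      VectorField.mlieBracket (𝓡 𝔫) (VectorField.mlieBracket (𝓡 𝔫) X Y) Z x +
      VectorField.mlieBracket (𝓡 𝔫) Y (VectorField.mlieBracket (𝓡 𝔫) X Z) x := by
  have : IsManifold (𝓡 𝔫) (minSmoothness ℝ 3) N :=
    .of_le (n := ∞) (by simpa using ENat.LEInfty.out)
  have h2 : minSmoothness ℝ 2 ≤ ∞ := by simpa using ENat.LEInfty.out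
  exact VectorField.leibniz_identity_mlieBracket_apply ((hX x).of_le h2) ((hY x).of_le h2)
    ((hZ x).of_le h2)

/-- Comes from the Jacobi identity instead of a coordinate computation: comparing it for `f • Z` and
for `Z`, everything cancels except the difference of the two sides, multiplied by `Z`. -/
theorem dScalar_mlieBracket {f : N → ℝ} (hf : ContMDiff (𝓡 𝔫) 𝓘(ℝ, ℝ) ∞ f)
    {X Y : Π x : N, TangentSpace (𝓡 𝔫) x} (hX : SmoothVectorField X) (hY : SmoothVectorField Y)
    (x : N) :
    dScalar f x (VectorField.mlieBracket (𝓡 𝔫) X Y x) =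
      dScalar (fun y => dScalar f y (Y y)) x (X x)
        - dScalar (fun y => dScalar f y (X y)) x (Y x) := by
  have key : ∀ Z : Π x : N, TangentSpace (𝓡 𝔫) x, SmoothVectorField Z →
      (dScalar (fun y => dScalar f y (Y y)) x (X x)
        - dScalar (fun y => dScalar f y (X y)) x (Y x)
        - dScalar f x (VectorField.mlieBracket (𝓡 𝔫) X Y x)) • Z x = 0 := by
    intro Z hZ
    have hXf := contMDiff_dScalar_apply hf hX
    have hYf := contMDiff_dScalar_apply hf hY
    have h1 := mlieBracket_jacobi hX hY (hZ.smul hf) x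
    have h2 := mlieBracket_jacobi hX hY hZ x
    rw [mlieBracket_smul_right_fun hf hZ, mlieBracket_smul_right_fun hf hZ,
      mlieBracket_smul_right_fun hf hZ,
      mlieBracket_add_right_fun (hZ.smul hYf) ((hY.mlieBracket hZ).smul hf),
      mlieBracket_add_right_fun (hZ.smul hXf) ((hX.mlieBracket hZ).smul hf),
      mlieBracket_smul_right_fun hYf hZ, mlieBracket_smul_right_fun hXf hZ,
      mlieBracket_smul_right_fun hf (hY.mlieBracket hZ),
      mlieBracket_smul_right_fun hf (hX.mlieBracket hZ)] at h1
    simp only [h2] at h1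
    rw [← sub_eq_zero] at h1
    rw [← h1]
    module
  -- The test field `Z` must not vanish at `x`; `X` or `Y` serves unless both vanish there, and then
  -- the bracket and both derivatives are zero at `x`.
  by_cases h1 : X x = 0
  · by_cases h2 : Y x = 0
    · rw [h1, h2, ← VectorField.mlieBracketWithin_univ,
        VectorField.mlieBracketWithin_eq_zero_of_eq_zero h1 h2]
      simp
    · have := (smul_eq_zero.1 (key Y hY)).resolve_right h2
      linarith
  · have := (smul_eq_zero.1 (key X hX)).resolve_right h1
    linarith

end SmoothFields

/-! ### Smoothness of the inverse of the ambient form -/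

section AmbientCoordinates

variable {E : Type*} [NormedAddCommGroup E] [NormedSpace ℝ E]

/-- The ambient form on a normed space, as a continuous bilinear form. -/
def ambientCLM (p : (E →L[ℝ] E →L[ℝ] ℝ) × (E →L[ℝ] ℝ) × ℝ) : E × ℝ →L[ℝ] E × ℝ →L[ℝ] ℝ :=
  p.1.bilinearComp (.fst ℝ E ℝ) (.fst ℝ E ℝ)
    + (ContinuousLinearMap.snd ℝ E ℝ).smulRight (p.2.1 ∘L .fst ℝ E ℝ)
    + (p.2.1 ∘L .fst ℝ E ℝ).smulRight (.snd ℝ E ℝ)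
    + p.2.2 • (ContinuousLinearMap.snd ℝ E ℝ).smulRight (.snd ℝ E ℝ)

theorem ambientCLM_apply (p : (E →L[ℝ] E →L[ℝ] ℝ) × (E →L[ℝ] ℝ) × ℝ) (u v : E × ℝ) :
    ambientCLM p u v =
      p.1 u.1 v.1 + u.2 * p.2.1 v.1 + v.2 * p.2.1 u.1 + u.2 * v.2 * p.2.2 := by
  simp [ambientCLM]
  ring

theorem contDiff_ambientCLM [FiniteDimensional ℝ E] : ContDiff ℝ ∞ (ambientCLM (E := E)) := by
  rw [contDiff_clm_apply_iff]
  intro u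
  rw [contDiff_clm_apply_iff]
  intro v
  simp only [ambientCLM_apply]
  fun_prop

/-- A dimension count. It turns non-degeneracy into the invertibility required for smoothness of
operator inversion. -/
theorem ContinuousLinearMap.isInvertible_of_injective_dual {V : Type*} [NormedAddCommGroup V]
    [NormedSpace ℝ V] [FiniteDimensional ℝ V] (A : V →L[ℝ] V →L[ℝ] ℝ)
    (hA : Function.Injective A) : A.IsInvertible := by
  have hrank : Module.finrank ℝ V = Module.finrank ℝ (V →L[ℝ] ℝ) := by
    rw [← (LinearMap.toContinuousLinearMap (𝕜 := ℝ) (E := V) (F' := ℝ)).finrank_eq]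
    exact (Subspace.dual_finrank_eq (K := ℝ) (V := V)).symm
  refine ⟨(LinearEquiv.ofInjectiveOfFinrankEq A.toLinearMap hA hrank).toContinuousLinearEquiv, ?_⟩
  ext u v
  rfl

end AmbientCoordinates

namespace MetricHypersurfaceData

variable {𝔫 : ℕ} {N : Type*} [TopologicalSpace N] [ChartedSpace (EuclideanSpace ℝ (Fin 𝔫)) N]
  [IsManifold (𝓡 𝔫) ∞ N] (d : MetricHypersurfaceData 𝔫 N)

/-- In a trivialization the sharp map is `A(x)⁻¹ ξ(x)`, where `A` and `ξ` depend smoothly on `x`,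
and inversion is smooth at invertible operators. Smoothness of `n`, `n⁽²⁾` and `P(α,·)` are all
special cases. -/
theorem contMDiffAt_ambientSharp {β : Π x : N, TangentSpace (𝓡 𝔫) x →L[ℝ] ℝ}
    (hβ : SmoothCovectorField β) {b : N → ℝ} (hb : ContMDiff (𝓡 𝔫) 𝓘(ℝ, ℝ) ∞ b) (x₀ : N) :
    ContMDiffAt (𝓡 𝔫) 𝓘(ℝ, EuclideanSpace ℝ (Fin 𝔫) × ℝ) ∞
      (fun x => ((trivializationAt (EuclideanSpace ℝ (Fin 𝔫)) (TangentSpace (𝓡 𝔫)) x₀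
        ⟨x, (d.ambientSharp x (β x, b x)).1⟩).2, (d.ambientSharp x (β x, b x)).2)) x₀ := by
  set E := EuclideanSpace ℝ (Fin 𝔫)
  set e := trivializationAt E (TangentSpace (𝓡 𝔫)) x₀ with he
  have hγ := ((contMDiffAt_hom_bundle _).1 (d.γ_smooth x₀)).2
  have hl := ((contMDiffAt_hom_bundle _).1 (d.l_smooth x₀)).2
  have hβ' := ((contMDiffAt_hom_bundle _).1 (hβ x₀)).2
  have hA := (contDiff_ambientCLM (E := E)).contMDiff.contMDiffAt.comp x₀
    (hγ.prodMk_space (hl.prodMk_space (d.l2_smooth x₀)))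
  have hξ : ContDiff ℝ ∞ (fun p : (E →L[ℝ] ℝ) × ℝ =>
      p.1 ∘L .fst ℝ E ℝ + p.2 • ContinuousLinearMap.snd ℝ E ℝ) := by fun_prop
  have hξ' := hξ.contMDiff.contMDiffAt.comp x₀ (hβ'.prodMk_space (hb x₀))
  set A := ambientCLM ∘ fun x =>
      (ContinuousLinearMap.inCoordinates E (TangentSpace (𝓡 𝔫)) (E →L[ℝ] ℝ)
        (fun x => TangentSpace (𝓡 𝔫) x →L[ℝ] ℝ) x₀ x x₀ x (d.γ x),
      ContinuousLinearMap.inCoordinates E (TangentSpace (𝓡 𝔫)) ℝ (Bundle.Trivial N ℝ)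
        x₀ x x₀ x (d.l x), d.l2 x) with hAdef
  have hAapp : ∀ y ∈ e.baseSet, ∀ u v : E × ℝ, A y u v =
      ambientForm (d.γ y) (d.l y) (d.l2 y) (e.symm y u.1, u.2) (e.symm y v.1, v.2) := by
    intro y hy u v
    simp only [hAdef, Function.comp, ambientCLM_apply, ambientForm, LinearMap.mk₂_apply]
    rw [inCoordinates_apply_eq₂ hy hy (by simp),
      ContinuousLinearMap.inCoordinates_eq hy (by simp)]
    simp [he]
  have hinv : ∀ y ∈ e.baseSet, (A y).IsInvertible := by
    intro y hy
    refine ContinuousLinearMap.isInvertible_of_injective_dual _ ?_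
    rw [injective_iff_map_eq_zero]
    intro u hu
    -- Every `q` in `T_y N × ℝ` has coordinates in `E × ℝ`, so a `u` killed by `A y` represents a
    -- vector in the radical of the ambient form.
    have h0 := (d.nondegenerate y).1 (e.symm y u.1, u.2) fun q => by
      have := hAapp y hy u ((e ⟨y, q.1⟩).2, q.2)
      rw [hu] at this
      simpa [e.symm_apply_apply_mk hy] using this.symm
    have h1 : (e.continuousLinearEquivAt ℝ y hy).symm u.1 = 0 := congrArg Prod.fst h0
    exact Prod.ext ((map_eq_zero_iff _ (ContinuousLinearEquiv.injective _)).1 h1) (congrArg Prod.snd h0 :)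
  have hinvA := ((hinv x₀ (FiberBundle.mem_baseSet_trivializationAt' x₀)).contDiffAt_map_inverse
    (n := ∞)).contMDiffAt.comp x₀ hA
  refine (hinvA.clm_apply hξ').congr_of_eventuallyEq ?_
  filter_upwards [e.open_baseSet.mem_nhds (FiberBundle.mem_baseSet_trivializationAt' x₀)] with y hy
  simp only [Function.comp]
  rw [eq_comm, (hinv y hy).inverse_apply_eq]
  refine ContinuousLinearMap.ext fun v => ?_
  rw [hAapp y hy, e.symm_apply_apply_mk hy]
  have := d.ambientForm_ambientSharp y (β y, b y) (e.symm y v.1, v.2)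
  refine Eq.trans ?_ this.symm
  rw [ContinuousLinearMap.inCoordinates_eq hy (by simp)]
  simp [he]

theorem smooth_ambientSharp_fst {β : Π x : N, TangentSpace (𝓡 𝔫) x →L[ℝ] ℝ}
    (hβ : SmoothCovectorField β) {b : N → ℝ} (hb : ContMDiff (𝓡 𝔫) 𝓘(ℝ, ℝ) ∞ b) :
    SmoothVectorField (fun x => (d.ambientSharp x (β x, b x)).1) := by
  intro x₀
  rw [contMDiffAt_section]
  exact ContMDiffAt.comp (g := Prod.fst) x₀ contDiff_fst.contMDiff.contMDiffAt
    (d.contMDiffAt_ambientSharp hβ hb x₀)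

theorem smooth_ambientSharp_snd {β : Π x : N, TangentSpace (𝓡 𝔫) x →L[ℝ] ℝ}
    (hβ : SmoothCovectorField β) {b : N → ℝ} (hb : ContMDiff (𝓡 𝔫) 𝓘(ℝ, ℝ) ∞ b) :
    ContMDiff (𝓡 𝔫) 𝓘(ℝ, ℝ) ∞ (fun x => (d.ambientSharp x (β x, b x)).2) := by
  intro x₀
  have h := d.contMDiffAt_ambientSharp hβ hb x₀
  have h2 := ContMDiffAt.comp (g := Prod.snd) x₀ contDiff_snd.contMDiff.contMDiffAt h
  exact h2

theorem smoothCovectorField_zero :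
    SmoothCovectorField (fun x : N => (0 : TangentSpace (𝓡 𝔫) x →L[ℝ] ℝ)) :=
  contMDiff_zeroSection ℝ (fun x : N => TangentSpace (𝓡 𝔫) x →L[ℝ] ℝ)

theorem n_smooth : SmoothVectorField d.n :=
  d.smooth_ambientSharp_fst smoothCovectorField_zero contMDiff_const

theorem n2_smooth : ContMDiff (𝓡 𝔫) 𝓘(ℝ, ℝ) ∞ d.n2 :=
  d.smooth_ambientSharp_snd smoothCovectorField_zero contMDiff_const

theorem raiseField_smooth {α : Π x : N, TangentSpace (𝓡 𝔫) x →L[ℝ] ℝ}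
    (hα : SmoothCovectorField α) : SmoothVectorField (d.raiseField α) :=
  d.smooth_ambientSharp_fst hα contMDiff_const

/-! ### Algebra of the inverse of the ambient form -/

theorem ambientSharp_snd (x : N) (α : TangentSpace (𝓡 𝔫) x →L[ℝ] ℝ) :
    (d.ambientSharp x (α, 0)).2 = α (d.n x) := by
  have h := d.ambientInverse_eq x α 0 0 1
  simpa [ambientInverse, P] using h

/-- This and the next three lemmas are the block components of "`𝓐` composed with its inverse is the
identity". This block is the splitting of `α` along `γ` and `ℓ`. -/
theorem γ_raise_add (x : N) (α : TangentSpace (𝓡 𝔫) x →L[ℝ] ℝ) (v : TangentSpace (𝓡 𝔫) x) :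
    d.γ x (d.raise x α) v + α (d.n x) * d.l x v = α v := by
  have h := d.ambientForm_ambientSharp x (α, 0) (v, 0)
  simpa [ambientForm, raise, ambientSharp_snd] using h

theorem l_raise (x : N) (α : TangentSpace (𝓡 𝔫) x →L[ℝ] ℝ) :
    d.l x (d.raise x α) = - (α (d.n x) * d.l2 x) := by
  have h := d.ambientForm_ambientSharp x (α, 0) (0, 1)
  simp only [ambientForm, LinearMap.mk₂_apply, ambientSharp_snd] at h
  simp only [raise]
  simp at h
  linarith

theorem γ_n (x : N) (v : TangentSpace (𝓡 𝔫) x) :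
    d.γ x (d.n x) v = - (d.n2 x * d.l x v) := by
  have h := d.ambientForm_ambientSharp x (0, 1) (v, 0)
  simp [ambientForm] at h
  simp only [n, n2]
  linarith

theorem l_n (x : N) : d.l x (d.n x) = 1 - d.n2 x * d.l2 x := by
  have h := d.ambientForm_ambientSharp x (0, 1) (0, 1)
  simp [ambientForm] at h
  simp only [n, n2]
  linarith

theorem P_symm (x : N) (α β : TangentSpace (𝓡 𝔫) x →L[ℝ] ℝ) : d.P x α β = d.P x β α := by
  -- Evaluates `γ(P(α,·), P(β,·))` in two ways; the `ℓ⁽²⁾` corrections agree.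
  have h1 := d.γ_raise_add x α (d.raise x β)
  have h2 := d.γ_raise_add x β (d.raise x α)
  rw [l_raise] at h1 h2
  rw [d.γ_symm] at h2
  simp only [P]
  linarith

/-- A tangent vector is determined by its contractions with `γ` and `ℓ`. -/
theorem ext_of_γ_l {x : N} {v w : TangentSpace (𝓡 𝔫) x} (hγ : ∀ z, d.γ x v z = d.γ x w z)
    (hl : d.l x v = d.l x w) : v = w := by
  have h := (d.nondegenerate x).1 (v - w, 0) fun q => by
    simp [ambientForm, hγ, hl]
  exact sub_eq_zero.1 (congrArg Prod.fst h)

/-! ### Smoothness of `F`, `s` and `U` on smooth vector fields -/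

theorem F_apply {X Y : Π x : N, TangentSpace (𝓡 𝔫) x} (hX : SmoothVectorField X)
    (hY : SmoothVectorField Y) (x : N) :
    d.F x (X x) (Y x) = 1 / 2 * (dScalar (fun y => d.l y (Y y)) x (X x)
      - dScalar (fun y => d.l y (X y)) x (Y x)
      - d.l x (VectorField.mlieBracket (𝓡 𝔫) X Y x)) := by
  rw [← extDerivOneForm_apply d.l_smooth (hX.differentiableFieldAt x) (hY.differentiableFieldAt x)]
  rfl

theorem U_apply {X Y : Π x : N, TangentSpace (𝓡 𝔫) x} (hX : SmoothVectorField X)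
    (hY : SmoothVectorField Y) (x : N) :
    d.U x (X x) (Y x) = 1 / 2 * (dScalar (fun y => d.γ y (X y) (Y y)) x (d.n x)
        - d.γ x (VectorField.mlieBracket (𝓡 𝔫) d.n X x) (Y x)
        - d.γ x (X x) (VectorField.mlieBracket (𝓡 𝔫) d.n Y x))
      + 1 / 2 * (d.l x (X x) * dScalar d.n2 x (Y x) + dScalar d.n2 x (X x) * d.l x (Y x)) := by
  rw [← lieDerivTwoTensor_apply d.n d.γ_smooth (hX.differentiableFieldAt x)
    (hY.differentiableFieldAt x)]
  rfl

theorem contMDiff_F {X Y : Π x : N, TangentSpace (𝓡 𝔫) x} (hX : SmoothVectorField X)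
    (hY : SmoothVectorField Y) : ContMDiff (𝓡 𝔫) 𝓘(ℝ, ℝ) ∞ (fun x => d.F x (X x) (Y x)) := by
  simp only [d.F_apply hX hY]
  exact contMDiff_const.mul (((contMDiff_dScalar_apply (d.l_smooth.apply hY) hX).sub
    (contMDiff_dScalar_apply (d.l_smooth.apply hX) hY)).sub
    (d.l_smooth.apply (hX.mlieBracket hY)))

theorem contMDiff_s {X : Π x : N, TangentSpace (𝓡 𝔫) x} (hX : SmoothVectorField X) :
    ContMDiff (𝓡 𝔫) 𝓘(ℝ, ℝ) ∞ (fun x => d.s x (X x)) :=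
  d.contMDiff_F d.n_smooth hX

theorem contMDiff_U {X Y : Π x : N, TangentSpace (𝓡 𝔫) x} (hX : SmoothVectorField X)
    (hY : SmoothVectorField Y) : ContMDiff (𝓡 𝔫) 𝓘(ℝ, ℝ) ∞ (fun x => d.U x (X x) (Y x)) := by
  simp only [d.U_apply hX hY]
  have hn := d.n_smooth
  have h1 := contMDiff_dScalar_apply (d.γ_smooth.apply hX hY) hn
  have h2 := d.γ_smooth.apply (hn.mlieBracket hX) hY
  have h3 := d.γ_smooth.apply hX (hn.mlieBracket hY)
  have h4 := (d.l_smooth.apply hX).mul (contMDiff_dScalar_apply d.n2_smooth hY)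
  have h5 := (contMDiff_dScalar_apply d.n2_smooth hX).mul (d.l_smooth.apply hY)
  exact (contMDiff_const.mul ((h1.sub h2).sub h3)).add (contMDiff_const.mul (h4.add h5))

theorem F_antisymm [T2Space N] (x : N) (v w : TangentSpace (𝓡 𝔫) x) :
    d.F x v w = - d.F x w v := by
  obtain ⟨X, hX, rfl⟩ := exists_smoothVectorField_eq x v
  obtain ⟨Y, hY, rfl⟩ := exists_smoothVectorField_eq x w
  rw [d.F_apply hX hY, d.F_apply hY hX, VectorField.mlieBracket_swap]
  simp
  ring

theorem U_symm [T2Space N] (x : N) (v w : TangentSpace (𝓡 𝔫) x) : d.U x v w = d.U x w v := by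
  obtain ⟨X, hX, rfl⟩ := exists_smoothVectorField_eq x v
  obtain ⟨Y, hY, rfl⟩ := exists_smoothVectorField_eq x w
  rw [d.U_apply hX hY, d.U_apply hY hX, d.γ_symm x (X x),
    d.γ_symm x (VectorField.mlieBracket (𝓡 𝔫) d.n X x)]
  simp only [fun y => d.γ_symm y (X y)]
  ring

/-- `U(n,·) = -n⁽²⁾ s + (1/2) dn⁽²⁾ + (1/2) (n⁽²⁾)² dℓ⁽²⁾`. -/
theorem U_n [T2Space N] (x : N) (v : TangentSpace (𝓡 𝔫) x) :
    d.U x (d.n x) v = - (d.n2 x * d.s x v) + 1 / 2 * dScalar d.n2 x v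
      + 1 / 2 * d.n2 x ^ 2 * dScalar d.l2 x v := by
  obtain ⟨X, hX, rfl⟩ := exists_smoothVectorField_eq x v
  have hF := d.F_apply d.n_smooth hX x
  have hU := d.U_apply d.n_smooth hX x
  -- `h1` and `h2` differentiate `γ(n,X) = -n⁽²⁾ ℓ(X)` along `n` and `ℓ(n) = 1 - n⁽²⁾ ℓ⁽²⁾` along
  -- `X`. The brackets `[n,X]` in `U` and in `s` then match, because `γ(n,[n,X]) = -n⁽²⁾ ℓ([n,X])`.
  have h1 : dScalar (fun y => d.γ y (d.n y) (X y)) x (d.n x) =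
      - (d.n2 x * dScalar (fun y => d.l y (X y)) x (d.n x) + d.l x (X x) * dScalar d.n2 x (d.n x)) := by
    simp only [γ_n]
    rw [dScalar_neg_apply, dScalar_mul_apply d.n2_smooth (d.l_smooth.apply hX)]
  have h2 : dScalar (fun y => d.l y (d.n y)) x (X x) =
      - (d.n2 x * dScalar d.l2 x (X x) + d.l2 x * dScalar d.n2 x (X x)) := by
    simp only [l_n]
    rw [dScalar_sub_apply (g := fun y => d.n2 y * d.l2 y) contMDiff_const (d.n2_smooth.mul d.l2_smooth), dScalar_const_apply,
      dScalar_mul_apply d.n2_smooth d.l2_smooth, zero_sub]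
  have h3 : VectorField.mlieBracket (𝓡 𝔫) d.n d.n x = 0 := by simp
  change d.s x (X x) = _ at hF
  rw [h1, h3, γ_n, l_n] at hU
  rw [h2] at hF
  rw [hU, hF]
  simp
  ring

end MetricHypersurfaceData

/-! ### First Bianchi identity for torsion-free connections -/

section Bianchi

variable {𝔫 : ℕ} {N : Type*} [TopologicalSpace N] [ChartedSpace (EuclideanSpace ℝ (Fin 𝔫)) N]
  [IsManifold (𝓡 𝔫) ∞ N]
  {D : CovariantDerivative (𝓡 𝔫) (EuclideanSpace ℝ (Fin 𝔫)) (TangentSpace (𝓡 𝔫) : N → Type _)}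

theorem mlieBracket_eq_covField_sub (hD : D.torsion = 0) {X Y : Π x : N, TangentSpace (𝓡 𝔫) x}
    (hX : SmoothVectorField X) (hY : SmoothVectorField Y) (x : N) :
    VectorField.mlieBracket (𝓡 𝔫) X Y x = covField D X Y x - covField D Y X x :=
  ((CovariantDerivative.torsion_eq_zero_iff D).1 hD (hX.differentiableFieldAt x)
    (hY.differentiableFieldAt x)).symm

theorem covField_covField_eq (hD : D.torsion = 0) (hs : D.ContMDiffCovariantDerivative ∞)
    {X Y : Π x : N, TangentSpace (𝓡 𝔫) x} (Z : Π x : N, TangentSpace (𝓡 𝔫) x)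
    (hX : SmoothVectorField X) (hY : SmoothVectorField Y) (x : N) :
    covField D Z (covField D X Y) x =
      covField D Z (VectorField.mlieBracket (𝓡 𝔫) X Y) x + covField D Z (covField D Y X) x := by
  have h : covField D X Y = VectorField.mlieBracket (𝓡 𝔫) X Y + covField D Y X := by
    funext y
    rw [Pi.add_apply, mlieBracket_eq_covField_sub hD hX hY]
    abel
  conv_lhs => rw [h]
  have := D.isCovariantDerivativeOnUniv.add ((hX.mlieBracket hY).differentiableFieldAt x)
    ((hY.covField hs hX).differentiableFieldAt x)
  exact congrArg (fun A => A (Z x)) this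

/-- Without torsion, each bracket is a difference of covariant derivatives, and the cyclic sum
collapses to the Jacobi identity. -/
theorem curvatureOp_bianchi (hD : D.torsion = 0) (hs : D.ContMDiffCovariantDerivative ∞)
    {X Y Z : Π x : N, TangentSpace (𝓡 𝔫) x} (hX : SmoothVectorField X)
    (hY : SmoothVectorField Y) (hZ : SmoothVectorField Z) (x : N) :
    curvatureOp D X Y Z x + curvatureOp D Y Z X x + curvatureOp D Z X Y x = 0 := by
  have j := mlieBracket_jacobi hX hY hZ x
  have hswap : VectorField.mlieBracket (𝓡 𝔫) X Z =
      (-1 : ℝ) • VectorField.mlieBracket (𝓡 𝔫) Z X := by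
    rw [VectorField.mlieBracket_swap, neg_one_smul]
  rw [VectorField.mlieBracket_swap_apply (V := VectorField.mlieBracket (𝓡 𝔫) X Y), hswap,
    VectorField.mlieBracket_const_smul_right ((hZ.mlieBracket hX).differentiableFieldAt x),
    mlieBracket_eq_covField_sub hD hX (hY.mlieBracket hZ),
    mlieBracket_eq_covField_sub hD hZ (hX.mlieBracket hY),
    mlieBracket_eq_covField_sub hD hY (hZ.mlieBracket hX)] at j
  simp only [curvatureOp]
  rw [covField_covField_eq hD hs X hY hZ, covField_covField_eq hD hs Y hZ hX,
    covField_covField_eq hD hs Z hX hY]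
  rw [← sub_eq_zero] at j
  rw [← j]
  module

theorem curvatureOp_swap {X Y : Π x : N, TangentSpace (𝓡 𝔫) x}
    (Z : Π x : N, TangentSpace (𝓡 𝔫) x) (x : N) :
    curvatureOp D X Y Z x = - curvatureOp D Y X Z x := by
  simp only [curvatureOp, covField, VectorField.mlieBracket_swap_apply (V := X), map_neg]
  abel

end Bianchi

/-! ### Covariant derivatives of `ℓ`, `γ` and `n`, and the Ricci identities -/

namespace MetricHypersurfaceData

variable {𝔫 : ℕ} {N : Type*} [TopologicalSpace N] [ChartedSpace (EuclideanSpace ℝ (Fin 𝔫)) N]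
  [IsManifold (𝓡 𝔫) ∞ N] {d : MetricHypersurfaceData 𝔫 N}
  {D : CovariantDerivative (𝓡 𝔫) (EuclideanSpace ℝ (Fin 𝔫)) (TangentSpace (𝓡 𝔫) : N → Type _)}

namespace IsMetricHypersurfaceConnection

/-- `(∇_X ℓ)(Z) = F(X,Z) - ℓ⁽²⁾ U(X,Z)`. -/
theorem dScalar_l (hD : d.IsMetricHypersurfaceConnection D)
    {X Z : Π x : N, TangentSpace (𝓡 𝔫) x} (hX : SmoothVectorField X)
    (hZ : SmoothVectorField Z) (x : N) :
    dScalar (fun y => d.l y (Z y)) x (X x) =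
      d.l x (covField D X Z x) + d.F x (X x) (Z x) - d.l2 x * d.U x (X x) (Z x) := by
  -- The defining equation prescribes the symmetric part of `∇ℓ`; `F`, by absence of torsion, is its
  -- antisymmetric part.
  have h1 := hD.cov_l X Z hX hZ x
  have h2 := d.F_apply hX hZ x
  rw [mlieBracket_eq_covField_sub hD.torsion_eq_zero hX hZ, map_sub] at h2
  simp only [covOneForm] at h1
  linarith

theorem dScalar_γ (hD : d.IsMetricHypersurfaceConnection D)
    {X Z W : Π x : N, TangentSpace (𝓡 𝔫) x} (hX : SmoothVectorField X)
    (hZ : SmoothVectorField Z) (hW : SmoothVectorField W) (x : N) :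
    dScalar (fun y => d.γ y (Z y) (W y)) x (X x) =
      d.γ x (covField D X Z x) (W x) + d.γ x (Z x) (covField D X W x)
        - d.U x (X x) (Z x) * d.l x (W x) - d.U x (X x) (W x) * d.l x (Z x) := by
  have h1 := hD.cov_γ X Z W hX hZ hW x
  simp only [covTwoTensor] at h1
  linarith

/-- `∇_W n = (s(W) - n⁽²⁾ W(ℓ⁽²⁾)) n + P(U(W,·) - n⁽²⁾ F(W,·), ·)`. -/
theorem covField_n [T2Space N] (hD : d.IsMetricHypersurfaceConnection D)
    {W : Π x : N, TangentSpace (𝓡 𝔫) x} (hW : SmoothVectorField W) (x : N) :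
    covField D W d.n x = (d.s x (W x) - d.n2 x * dScalar d.l2 x (W x)) • d.n x
      + d.raise x (d.U x (W x) - d.n2 x • d.F x (W x)) := by
  have hn := d.n_smooth
  have hs : d.F x (W x) (d.n x) = - d.s x (W x) := d.F_antisymm x _ _
  have hU : d.U x (W x) (d.n x) = _ := (d.U_symm x _ _).trans (d.U_n x (W x))
  -- The contraction with `γ` follows by differentiating `γ(n,Z) = -n⁽²⁾ ℓ(Z)` along `W`, the one
  -- with `ℓ` by differentiating `ℓ(n) = 1 - n⁽²⁾ ℓ⁽²⁾`.
  refine d.ext_of_γ_l (fun z => ?_) ?_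
  · obtain ⟨Z, hZ, rfl⟩ := exists_smoothVectorField_eq x z
    have h1 := hD.dScalar_γ hW hn hZ x
    have h2 := d.γ_raise_add x (d.U x (W x) - d.n2 x • d.F x (W x)) (Z x)
    have h3 := hD.dScalar_l hW hZ x
    simp only [γ_n] at h1
    rw [dScalar_neg_apply, dScalar_mul_apply d.n2_smooth (d.l_smooth.apply hZ), h3, l_n] at h1
    simp only [map_add, map_smul, add_apply, sub_apply, smul_apply, smul_eq_mul, γ_n, hs, hU]
      at h1 h2 ⊢
    linear_combination -h1 - h2
  · have h1 := hD.dScalar_l hW hn x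
    simp only [l_n] at h1
    rw [dScalar_sub_apply (g := fun y => d.n2 y * d.l2 y) contMDiff_const
      (d.n2_smooth.mul d.l2_smooth), dScalar_const_apply,
      dScalar_mul_apply d.n2_smooth d.l2_smooth] at h1
    simp only [map_add, map_smul, sub_apply, smul_apply, smul_eq_mul, l_raise, l_n, hs, hU]
      at h1 ⊢
    linear_combination -h1

/-- The Ricci identity for `ℓ`. -/
theorem l_curvatureOp (hD : d.IsMetricHypersurfaceConnection D)
    {X Y Z : Π x : N, TangentSpace (𝓡 𝔫) x} (hX : SmoothVectorField X)
    (hY : SmoothVectorField Y) (hZ : SmoothVectorField Z) (x : N) :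
    d.l x (curvatureOp D X Y Z x) =
      - (covTwoTensor D d.F X Y Z x - dScalar d.l2 x (X x) * d.U x (Y x) (Z x)
        - d.l2 x * covTwoTensor D d.U X Y Z x)
      + (covTwoTensor D d.F Y X Z x - dScalar d.l2 x (Y x) * d.U x (X x) (Z x)
        - d.l2 x * covTwoTensor D d.U Y X Z x) := by
  -- Differentiates `ℓ(∇_Y Z) = Y(ℓ(Z)) - F(Y,Z) + ℓ⁽²⁾ U(Y,Z)` along `X`. After antisymmetrising,
  -- the second derivatives of `ℓ(Z)` combine into a derivative along `[X,Y]`.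
  have key : ∀ {X Y : Π x : N, TangentSpace (𝓡 𝔫) x}, SmoothVectorField X → SmoothVectorField Y →
      d.l x (covField D X (covField D Y Z) x) =
        dScalar (fun y => dScalar (fun y => d.l y (Z y)) y (Y y)) x (X x)
        - dScalar (fun y => d.F y (Y y) (Z y)) x (X x)
        + (d.l2 x * dScalar (fun y => d.U y (Y y) (Z y)) x (X x)
          + d.U x (Y x) (Z x) * dScalar d.l2 x (X x))
        - d.F x (X x) (covField D Y Z x) + d.l2 x * d.U x (X x) (covField D Y Z x) := by
    intro X Y hX hY
    have h1 := hD.dScalar_l hX (hY.covField hD.smooth hZ) x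
    have h2 : (fun y => d.l y (covField D Y Z y)) = fun y =>
        (dScalar (fun y => d.l y (Z y)) y (Y y) - d.F y (Y y) (Z y))
          + d.l2 y * d.U y (Y y) (Z y) := by
      funext y
      linear_combination - hD.dScalar_l hY hZ y
    have s1 := contMDiff_dScalar_apply (d.l_smooth.apply hZ) hY
    have s2 : ContMDiff (𝓡 𝔫) 𝓘(ℝ, ℝ) ∞ (fun y => d.l2 y * d.U y (Y y) (Z y)) :=
      d.l2_smooth.mul (d.contMDiff_U hY hZ)
    have s3 : ContMDiff (𝓡 𝔫) 𝓘(ℝ, ℝ) ∞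
        (fun y => dScalar (fun y => d.l y (Z y)) y (Y y) - d.F y (Y y) (Z y)) :=
      s1.sub (d.contMDiff_F hY hZ)
    rw [h2, dScalar_add_apply s3 s2,
      dScalar_sub_apply s1 (d.contMDiff_F hY hZ),
      dScalar_mul_apply d.l2_smooth (d.contMDiff_U hY hZ)] at h1
    linear_combination -h1
  have h3 := hD.dScalar_l (hX.mlieBracket hY) hZ x
  rw [dScalar_mlieBracket (d.l_smooth.apply hZ) hX hY] at h3
  have h4 := mlieBracket_eq_covField_sub hD.torsion_eq_zero hX hY x
  have h5 : d.F x (VectorField.mlieBracket (𝓡 𝔫) X Y x) (Z x) =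
    d.F x (covField D X Y x) (Z x) - d.F x (covField D Y X x) (Z x) := by rw [h4]; simp
  have h6 : d.U x (VectorField.mlieBracket (𝓡 𝔫) X Y x) (Z x) =
    d.U x (covField D X Y x) (Z x) - d.U x (covField D Y X x) (Z x) := by rw [h4]; simp
  rw [h5, h6] at h3
  simp only [curvatureOp, covTwoTensor, map_sub, key hX hY, key hY hX]
  linear_combination h3

/-- The Ricci identity for `γ`. -/
theorem γ_curvatureOp_add (hD : d.IsMetricHypersurfaceConnection D)
    {X Y Z W : Π x : N, TangentSpace (𝓡 𝔫) x} (hX : SmoothVectorField X)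
    (hY : SmoothVectorField Y) (hZ : SmoothVectorField Z) (hW : SmoothVectorField W) (x : N) :
    d.γ x (curvatureOp D X Y Z x) (W x) + d.γ x (curvatureOp D X Y W x) (Z x) =
      (covTwoTensor D d.U X Y Z x - covTwoTensor D d.U Y X Z x) * d.l x (W x)
      + (covTwoTensor D d.U X Y W x - covTwoTensor D d.U Y X W x) * d.l x (Z x)
      + d.U x (Y x) (Z x) * (d.F x (X x) (W x) - d.l2 x * d.U x (X x) (W x))
      + d.U x (Y x) (W x) * (d.F x (X x) (Z x) - d.l2 x * d.U x (X x) (Z x))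
      - d.U x (X x) (Z x) * (d.F x (Y x) (W x) - d.l2 x * d.U x (Y x) (W x))
      - d.U x (X x) (W x) * (d.F x (Y x) (Z x) - d.l2 x * d.U x (Y x) (Z x)) := by
  -- Only the sum symmetrised in `Z`, `W` is controlled by second derivatives of `γ(Z,W)`. The
  -- products of first covariant derivatives of `Z` and `W` are symmetric in `X`, `Y` and drop out
  -- on antisymmetrising.
  have key : ∀ {X Y : Π x : N, TangentSpace (𝓡 𝔫) x}, SmoothVectorField X → SmoothVectorField Y →
      d.γ x (covField D X (covField D Y Z) x) (W x)
        + d.γ x (covField D X (covField D Y W) x) (Z x) =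
        dScalar (fun y => dScalar (fun y => d.γ y (Z y) (W y)) y (Y y)) x (X x)
        + (d.U x (Y x) (Z x) * (d.l x (covField D X W x) + d.F x (X x) (W x)
            - d.l2 x * d.U x (X x) (W x))
          + d.l x (W x) * dScalar (fun y => d.U y (Y y) (Z y)) x (X x))
        + (d.U x (Y x) (W x) * (d.l x (covField D X Z x) + d.F x (X x) (Z x)
            - d.l2 x * d.U x (X x) (Z x))
          + d.l x (Z x) * dScalar (fun y => d.U y (Y y) (W y)) x (X x))
        - d.γ x (covField D Y Z x) (covField D X W x) - d.γ x (covField D X Z x) (covField D Y W x)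
        + d.U x (X x) (covField D Y Z x) * d.l x (W x)
        + d.U x (X x) (W x) * d.l x (covField D Y Z x)
        + d.U x (X x) (covField D Y W x) * d.l x (Z x)
        + d.U x (X x) (Z x) * d.l x (covField D Y W x) := by
    intro X Y hX hY
    have hYZ := hY.covField hD.smooth hZ
    have hYW := hY.covField hD.smooth hW
    have h1 := hD.dScalar_γ hX hYZ hW x
    have h1' := hD.dScalar_γ hX hZ hYW x
    have h2 : (fun y => d.γ y (covField D Y Z y) (W y) + d.γ y (Z y) (covField D Y W y)) = fun y =>
        (dScalar (fun y => d.γ y (Z y) (W y)) y (Y y) + d.U y (Y y) (Z y) * d.l y (W y))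
          + d.U y (Y y) (W y) * d.l y (Z y) := by
      funext y
      linear_combination - hD.dScalar_γ hY hZ hW y
    have h3 := dScalar_add_apply (d.γ_smooth.apply hYZ hW) (d.γ_smooth.apply hZ hYW) x (X x)
    have s1 := contMDiff_dScalar_apply (d.γ_smooth.apply hZ hW) hY
    have u1 := d.contMDiff_U hY hZ
    have u2 := d.contMDiff_U hY hW
    have l1 := d.l_smooth.apply hZ
    have l2 := d.l_smooth.apply hW
    have p1 : ContMDiff (𝓡 𝔫) 𝓘(ℝ, ℝ) ∞ (fun y => d.U y (Y y) (Z y) * d.l y (W y)) := u1.mul l2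
    have p2 : ContMDiff (𝓡 𝔫) 𝓘(ℝ, ℝ) ∞ (fun y => d.U y (Y y) (W y) * d.l y (Z y)) := u2.mul l1
    have p3 : ContMDiff (𝓡 𝔫) 𝓘(ℝ, ℝ) ∞ (fun y => dScalar (fun y => d.γ y (Z y) (W y)) y (Y y)
        + d.U y (Y y) (Z y) * d.l y (W y)) := s1.add p1
    rw [h2, dScalar_add_apply p3 p2, dScalar_add_apply s1 p1,
      dScalar_mul_apply u1 l2, dScalar_mul_apply u2 l1, hD.dScalar_l hX hW, hD.dScalar_l hX hZ,
      h1, h1', d.γ_symm x (Z x)] at h3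
    linear_combination -h3
  have h3 := hD.dScalar_γ (hX.mlieBracket hY) hZ hW x
  rw [dScalar_mlieBracket (d.γ_smooth.apply hZ hW) hX hY, d.γ_symm x (Z x)] at h3
  have h4 := mlieBracket_eq_covField_sub hD.torsion_eq_zero hX hY x
  have h5 : ∀ v, d.U x (VectorField.mlieBracket (𝓡 𝔫) X Y x) v =
    d.U x (covField D X Y x) v - d.U x (covField D Y X x) v := by intro v; rw [h4]; simp
  rw [h5, h5] at h3
  simp only [curvatureOp, covTwoTensor, map_sub, sub_apply]
  linear_combination h3 + key hX hY - key hY hX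
end IsMetricHypersurfaceConnection

end MetricHypersurfaceData

/-! ### Symmetries of the derivatives and contractions with `n` -/

/-- Symmetry of Hessians for a torsion-free connection. Those of `n⁽²⁾` and `ℓ⁽²⁾` arise from
differentiating `U(n,·)` and must cancel in the end. -/
theorem covOneForm_dScalar_symm {𝔫 : ℕ} {N : Type*} [TopologicalSpace N]
    [ChartedSpace (EuclideanSpace ℝ (Fin 𝔫)) N] [IsManifold (𝓡 𝔫) ∞ N]
    {D : CovariantDerivative (𝓡 𝔫) (EuclideanSpace ℝ (Fin 𝔫)) (TangentSpace (𝓡 𝔫) : N → Type _)}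
    (hD : D.torsion = 0) {f : N → ℝ} (hf : ContMDiff (𝓡 𝔫) 𝓘(ℝ, ℝ) ∞ f)
    {X Y : Π x : N, TangentSpace (𝓡 𝔫) x} (hX : SmoothVectorField X) (hY : SmoothVectorField Y)
    (x : N) : covOneForm D (dScalar f) X Y x = covOneForm D (dScalar f) Y X x := by
  have h := dScalar_mlieBracket hf hX hY x
  rw [mlieBracket_eq_covField_sub hD hX hY, map_sub] at h
  simp only [covOneForm]
  linarith

namespace MetricHypersurfaceData

variable {𝔫 : ℕ} {N : Type*} [TopologicalSpace N] [ChartedSpace (EuclideanSpace ℝ (Fin 𝔫)) N]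
  [IsManifold (𝓡 𝔫) ∞ N] {d : MetricHypersurfaceData 𝔫 N}
  {D : CovariantDerivative (𝓡 𝔫) (EuclideanSpace ℝ (Fin 𝔫)) (TangentSpace (𝓡 𝔫) : N → Type _)}

theorem P_sub_smul_left (x : N) (α β δ : TangentSpace (𝓡 𝔫) x →L[ℝ] ℝ) (c : ℝ) :
    d.P x (α - c • β) δ = d.P x α δ - c * d.P x β δ := by
  -- Linearity is immediate only in the second slot of `P`, so symmetry moves the combination there.
  rw [d.P_symm x _ δ, d.P_symm x α δ, d.P_symm x β δ]
  simp [P]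

theorem covTwoTensor_U_symm [T2Space N] (X Y Z : Π x : N, TangentSpace (𝓡 𝔫) x) (x : N) :
    covTwoTensor D d.U X Y Z x = covTwoTensor D d.U X Z Y x := by
  simp only [covTwoTensor, d.U_symm _ (Z _), d.U_symm _ _ (covField D X Z _)]
  rw [d.U_symm x (covField D X Z x)]
  ring

theorem covTwoTensor_F_antisymm [T2Space N] (X Y Z : Π x : N, TangentSpace (𝓡 𝔫) x) (x : N) :
    covTwoTensor D d.F X Y Z x = - covTwoTensor D d.F X Z Y x := by
  have h : (fun y => d.F y (Y y) (Z y)) = fun y => - d.F y (Z y) (Y y) :=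
    funext fun y => d.F_antisymm y _ _
  simp only [covTwoTensor]
  rw [h, dScalar_neg_apply, d.F_antisymm x (covField D X Y x), d.F_antisymm x (Y x)]
  ring

namespace IsMetricHypersurfaceConnection

/-- `F` is closed. -/
theorem covTwoTensor_F_cyclic [T2Space N] (hD : d.IsMetricHypersurfaceConnection D)
    {X Y Z : Π x : N, TangentSpace (𝓡 𝔫) x} (hX : SmoothVectorField X)
    (hY : SmoothVectorField Y) (hZ : SmoothVectorField Z) (x : N) :
    covTwoTensor D d.F X Y Z x + covTwoTensor D d.F Y Z X x + covTwoTensor D d.F Z X Y x = 0 := by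
  -- Closedness is read off by applying `ℓ` to the first Bianchi identity: the `U` terms cancel by
  -- symmetry, and each derivative of `F` occurs twice with a minus sign.
  have h := congrArg (d.l x) (curvatureOp_bianchi hD.torsion_eq_zero hD.smooth hX hY hZ x)
  simp only [map_add, map_zero] at h
  rw [hD.l_curvatureOp hX hY hZ, hD.l_curvatureOp hY hZ hX, hD.l_curvatureOp hZ hX hY,
    covTwoTensor_F_antisymm Y X Z, covTwoTensor_F_antisymm Z Y X, covTwoTensor_F_antisymm X Z Y,
    covTwoTensor_U_symm Y X Z, covTwoTensor_U_symm Z Y X, covTwoTensor_U_symm X Z Y,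
    d.U_symm x (X x) (Z x), d.U_symm x (Y x) (X x), d.U_symm x (Z x) (Y x)] at h
  linear_combination (-1 / 2) * h

theorem U_covField_n [T2Space N] (hD : d.IsMetricHypersurfaceConnection D)
    {Y : Π x : N, TangentSpace (𝓡 𝔫) x} (hY : SmoothVectorField Y) (x : N)
    (v : TangentSpace (𝓡 𝔫) x) :
    d.U x (covField D Y d.n x) v =
      (d.s x (Y x) - d.n2 x * dScalar d.l2 x (Y x)) * d.U x (d.n x) v
        + d.P x (d.U x (Y x)) (d.U x v) - d.n2 x * d.P x (d.U x v) (d.F x (Y x)) := by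
  rw [hD.covField_n hY, map_add, map_smul, add_apply, smul_apply, d.U_symm x (d.raise x _) v]
  change _ + d.P x _ _ = _
  rw [P_sub_smul_left, d.P_symm x (d.F x (Y x))]
  simp only [smul_eq_mul]
  ring

theorem F_covField_n [T2Space N] (hD : d.IsMetricHypersurfaceConnection D)
    {Y : Π x : N, TangentSpace (𝓡 𝔫) x} (hY : SmoothVectorField Y) (x : N)
    (v : TangentSpace (𝓡 𝔫) x) :
    d.F x (covField D Y d.n x) v =
      (d.s x (Y x) - d.n2 x * dScalar d.l2 x (Y x)) * d.s x v
        - d.P x (d.U x (Y x)) (d.F x v) + d.n2 x * d.P x (d.F x (Y x)) (d.F x v) := by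
  rw [hD.covField_n hY, map_add, map_smul, add_apply, smul_apply, d.F_antisymm x (d.raise x _) v]
  change _ + - d.P x _ _ = _
  rw [P_sub_smul_left]
  simp only [smul_eq_mul, s]
  ring

theorem covTwoTensor_F_n [T2Space N] (hD : d.IsMetricHypersurfaceConnection D)
    {Y : Π x : N, TangentSpace (𝓡 𝔫) x} (Z : Π x : N, TangentSpace (𝓡 𝔫) x)
    (hY : SmoothVectorField Y) (x : N) :
    covTwoTensor D d.F Y d.n Z x = covOneForm D d.s Y Z x
      - ((d.s x (Y x) - d.n2 x * dScalar d.l2 x (Y x)) * d.s x (Z x)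
        - d.P x (d.U x (Y x)) (d.F x (Z x)) + d.n2 x * d.P x (d.F x (Y x)) (d.F x (Z x))) := by
  rw [← hD.F_covField_n hY]
  simp only [covTwoTensor, covOneForm, s]
  ring

/-- Leibniz rule: differentiate the closed form of `U(n,·)` and subtract `U(∇_Y n, Z)`. -/
theorem covTwoTensor_U_n [T2Space N] (hD : d.IsMetricHypersurfaceConnection D)
    {Y Z : Π x : N, TangentSpace (𝓡 𝔫) x} (hY : SmoothVectorField Y) (hZ : SmoothVectorField Z)
    (x : N) :
    covTwoTensor D d.U Y d.n Z x =
      - dScalar d.n2 x (Y x) * d.s x (Z x) - d.n2 x * covOneForm D d.s Y Z x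
      + 1 / 2 * covOneForm D (dScalar d.n2) Y Z x
      + d.n2 x * dScalar d.n2 x (Y x) * dScalar d.l2 x (Z x)
      + 1 / 2 * d.n2 x ^ 2 * covOneForm D (dScalar d.l2) Y Z x
      - ((d.s x (Y x) - d.n2 x * dScalar d.l2 x (Y x)) * d.U x (d.n x) (Z x)
        + d.P x (d.U x (Y x)) (d.U x (Z x)) - d.n2 x * d.P x (d.U x (Z x)) (d.F x (Y x))) := by
  rw [← hD.U_covField_n hY]
  have h : (fun y => d.U y (d.n y) (Z y)) = fun y => d.n2 y * (1 / 2 * (d.n2 y *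
      dScalar d.l2 y (Z y)) - d.s y (Z y)) + 1 / 2 * dScalar d.n2 y (Z y) := by
    funext y
    rw [U_n]
    ring
  have s0 := contMDiff_dScalar_apply d.l2_smooth hZ
  have s1 : ContMDiff (𝓡 𝔫) 𝓘(ℝ, ℝ) ∞ (fun y => d.n2 y * dScalar d.l2 y (Z y)) :=
    d.n2_smooth.mul s0
  have s2 : ContMDiff (𝓡 𝔫) 𝓘(ℝ, ℝ) ∞ (fun y => 1 / 2 * (d.n2 y * dScalar d.l2 y (Z y))) :=
    contMDiff_const.mul s1
  have s3 := d.contMDiff_s hZ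
  have s4 : ContMDiff (𝓡 𝔫) 𝓘(ℝ, ℝ) ∞
      (fun y => 1 / 2 * (d.n2 y * dScalar d.l2 y (Z y)) - d.s y (Z y)) := s2.sub s3
  have s5 : ContMDiff (𝓡 𝔫) 𝓘(ℝ, ℝ) ∞
      (fun y => d.n2 y * (1 / 2 * (d.n2 y * dScalar d.l2 y (Z y)) - d.s y (Z y))) :=
    d.n2_smooth.mul s4
  have s6 := contMDiff_dScalar_apply d.n2_smooth hZ
  have s7 : ContMDiff (𝓡 𝔫) 𝓘(ℝ, ℝ) ∞ (fun y => 1 / 2 * dScalar d.n2 y (Z y)) :=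
    contMDiff_const.mul s6
  simp only [covTwoTensor, covOneForm]
  rw [h, dScalar_add_apply s5 s7, dScalar_mul_apply d.n2_smooth s4, dScalar_sub_apply s2 s3,
    dScalar_mul_apply contMDiff_const s1, dScalar_mul_apply d.n2_smooth s0,
    dScalar_mul_apply contMDiff_const s6, dScalar_const_apply, U_n]
  ring

/-- The pair symmetry defect of `γ(R(·,·)·,·)` in terms of its failure to be antisymmetric in the
last two arguments. -/
theorem γ_curvatureOp_pair (hD : d.IsMetricHypersurfaceConnection D)
    {X Y Z W : Π x : N, TangentSpace (𝓡 𝔫) x} (hX : SmoothVectorField X)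
    (hY : SmoothVectorField Y) (hZ : SmoothVectorField Z) (hW : SmoothVectorField W) (x : N) :
    2 * (d.γ x (curvatureOp D X Y Z x) (W x) - d.γ x (curvatureOp D Z W X x) (Y x)) =
      (d.γ x (curvatureOp D X Y Z x) (W x) + d.γ x (curvatureOp D X Y W x) (Z x))
      - (d.γ x (curvatureOp D Z W X x) (Y x) + d.γ x (curvatureOp D Z W Y x) (X x))
      - (d.γ x (curvatureOp D Y Z X x) (W x) + d.γ x (curvatureOp D Y Z W x) (X x))
      + (d.γ x (curvatureOp D W X Y x) (Z x) + d.γ x (curvatureOp D W X Z x) (Y x))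
      - (d.γ x (curvatureOp D Z X Y x) (W x) + d.γ x (curvatureOp D Z X W x) (Y x))
      - (d.γ x (curvatureOp D W Y X x) (Z x) + d.γ x (curvatureOp D W Y Z x) (X x)) := by
  have B : ∀ {X Y Z : Π x : N, TangentSpace (𝓡 𝔫) x}, SmoothVectorField X → SmoothVectorField Y →
      SmoothVectorField Z → ∀ v : TangentSpace (𝓡 𝔫) x, d.γ x (curvatureOp D X Y Z x) v
        + d.γ x (curvatureOp D Y Z X x) v + d.γ x (curvatureOp D Z X Y x) v = 0 := by
    intro X Y Z hX hY hZ v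
    rw [← add_apply, ← add_apply, ← map_add, ← map_add,
      curvatureOp_bianchi hD.torsion_eq_zero hD.smooth hX hY hZ, map_zero, zero_apply]
  have A : ∀ X Y Z : Π x : N, TangentSpace (𝓡 𝔫) x, ∀ v : TangentSpace (𝓡 𝔫) x,
      d.γ x (curvatureOp D X Y Z x) v = - d.γ x (curvatureOp D Y X Z x) v := by
    intro X Y Z v
    rw [curvatureOp_swap, map_neg, neg_apply]
  -- The classical argument with four Bianchi identities, one for each omitted field; the last-pair
  -- defects, zero in the metric case, are kept.
  linarith [B hX hY hZ (W x), B hY hZ hW (X x), B hZ hW hX (Y x), B hW hX hY (Z x),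
    A X Z W (Y x), A W Y X (Z x), A W Z Y (X x), A Z Y X (W x), A X W Y (Z x), A Y X Z (W x),
    A X Z Y (W x), A W Y Z (X x), A Y W X (Z x), A Y W Z (X x)]

/-- The main computation, with `a` in the role of `α(n)`. Of `V` only `ℓ(V) = -a ℓ⁽²⁾` is needed; it
makes the `∇_n U` terms of the `γ` and `ℓ` parts cancel. -/
theorem γ_curvatureOp_n [T2Space N] (hD : d.IsMetricHypersurfaceConnection D)
    {V W X : Π x : N, TangentSpace (𝓡 𝔫) x} (hV : SmoothVectorField V)
    (hW : SmoothVectorField W) (hX : SmoothVectorField X) (x : N) (a : ℝ)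
    (ha : d.l x (V x) = - (a * d.l2 x)) :
    d.γ x (curvatureOp D d.n X W x) (V x) + a * d.l x (curvatureOp D d.n X W x) =
      a *
        (covOneForm D d.s W X x - d.s x (X x) * d.s x (W x)
          + d.n2 x * (d.s x (W x) * dScalar d.l2 x (X x) + d.s x (X x) * dScalar d.l2 x (W x))
          + dScalar d.l2 x (d.n x) * d.U x (W x) (X x)
          + d.P x (d.U x (W x) - d.n2 x • d.F x (W x)) (d.F x (X x))
          - 1 / 2 * dScalar d.n2 x (W x) * dScalar d.l2 x (X x)
          - 1 / 2 * d.n2 x ^ 2 * dScalar d.l2 x (W x) * dScalar d.l2 x (X x))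
      + (covTwoTensor D d.U W V X x - covTwoTensor D d.U V W X x
          + 2 * d.s x (V x) * d.U x (W x) (X x) - d.s x (W x) * d.U x (X x) (V x)
          + 1 / 2 * d.F x (V x) (X x) * dScalar d.n2 x (W x)
          + d.n2 x * (- (d.U x (W x) (X x) * dScalar d.l2 x (V x))
            + d.U x (X x) (V x) * dScalar d.l2 x (W x)
            - covTwoTensor D d.F X V W x
            + d.F x (X x) (V x) * (d.s x (W x) - 1 / 2 * d.n2 x * dScalar d.l2 x (W x)))) := by
  have hn := d.n_smooth
  have ht := hD.torsion_eq_zero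
  have hp := hD.γ_curvatureOp_pair hn hX hW hV x
  rw [hD.γ_curvatureOp_add hn hX hW hV, hD.γ_curvatureOp_add hX hW hn hV,
    hD.γ_curvatureOp_add hV hn hX hW, hD.γ_curvatureOp_add hW hn hX hV,
    hD.γ_curvatureOp_add hV hX hn hW] at hp
  have hq := hD.γ_curvatureOp_add hW hV hn hX x
  rw [hq] at hp
  -- Trades `γ(R(W,V)X, n)` for `-n⁽²⁾ ℓ(R(W,V)X)`, which the Ricci identity for `ℓ` evaluates.
  rw [d.γ_symm x _ (d.n x), γ_n, hD.l_curvatureOp hW hV hX] at hq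
  rw [hD.l_curvatureOp hn hX hW]
  have FU : ∀ v, d.F x v (d.n x) = - d.s x v := fun v => d.F_antisymm x _ _
  have Fn : ∀ v, d.F x (d.n x) v = d.s x v := fun v => rfl
  have UU : ∀ v, d.U x v (d.n x) = d.U x (d.n x) v := fun v => d.U_symm x _ _
  have DU : ∀ Y Z, covTwoTensor D d.U Y Z d.n x = covTwoTensor D d.U Y d.n Z x :=
    fun Y Z => covTwoTensor_U_symm Y Z d.n x
  have DF : ∀ Y Z, covTwoTensor D d.F Y Z d.n x = - covTwoTensor D d.F Y d.n Z x :=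
    fun Y Z => covTwoTensor_F_antisymm Y Z d.n x
  -- Closedness of `F` removes its derivatives along `n` and along `V`.
  have c1 : covTwoTensor D d.F d.n X W x =
      covTwoTensor D d.F X d.n W x - covTwoTensor D d.F W d.n X x := by
    linear_combination hD.covTwoTensor_F_cyclic hn hX hW x - DF X W
  have c2 : covTwoTensor D d.F V W X x =
      covTwoTensor D d.F W V X x - covTwoTensor D d.F X V W x := by
    linear_combination hD.covTwoTensor_F_cyclic hV hW hX x - covTwoTensor_F_antisymm W X V x
  simp only [c1, c2, DU, FU, Fn, UU, hD.covTwoTensor_F_n _ hX, hD.covTwoTensor_F_n _ hW,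
    hD.covTwoTensor_U_n hX hW, hD.covTwoTensor_U_n hX hV,
    hD.covTwoTensor_U_n hW hX, hD.covTwoTensor_U_n hW hV, hD.covTwoTensor_U_n hV hX,
    hD.covTwoTensor_U_n hV hW, U_n, ha, l_n, P_sub_smul_left,
    covTwoTensor_U_symm _ X V, covTwoTensor_U_symm _ X W, covTwoTensor_U_symm _ W V,
    d.U_symm x (X x) (V x), d.U_symm x (X x) (W x), d.U_symm x (W x) (V x),
    d.F_antisymm x (X x) (V x), d.F_antisymm x (X x) (W x), d.F_antisymm x (W x) (V x),
    d.P_symm x (d.U x (X x)) (d.U x (V x)), d.P_symm x (d.U x (X x)) (d.U x (W x)),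
    d.P_symm x (d.U x (W x)) (d.U x (V x)),
    d.P_symm x (d.F x (X x)) (d.F x (W x)),
    covOneForm_dScalar_symm ht d.n2_smooth hX hV, covOneForm_dScalar_symm ht d.n2_smooth hX hW,
    covOneForm_dScalar_symm ht d.n2_smooth hW hV,
    covOneForm_dScalar_symm ht d.l2_smooth hX hV, covOneForm_dScalar_symm ht d.l2_smooth hX hW,
    covOneForm_dScalar_symm ht d.l2_smooth hW hV] at hp hq ⊢
  -- The rewriting above brings each symmetric or antisymmetric pair to one order, so equal terms
  -- are equal atoms. The factor `1/2` undoes the `2` in the pair identity, and adding `hq`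
  -- eliminates `γ(R(W,V)n, X)`.
  linear_combination (1 / 2) * hp + hq

end IsMetricHypersurfaceConnection

end MetricHypersurfaceData

end

theorem proposition2p12 {𝔫 : ℕ} {N : Type*} [TopologicalSpace N] [T2Space N]
    [ChartedSpace (EuclideanSpace ℝ (Fin 𝔫)) N] [IsManifold (𝓡 𝔫) ∞ N]
    (d : MetricHypersurfaceData 𝔫 N)
    (D : CovariantDerivative (𝓡 𝔫) (EuclideanSpace ℝ (Fin 𝔫)) (TangentSpace (𝓡 𝔫) : N → Type _))
    (hD : d.IsMetricHypersurfaceConnection D)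
    -- `α` occupies the slot `d`, `W` the slot `b` and `X` the slot `a` of the curvature tensor
    (α : Π x : N, TangentSpace (𝓡 𝔫) x →L[ℝ] ℝ) (W X : Π x : N, TangentSpace (𝓡 𝔫) x)
    (hα : SmoothCovectorField α) (hW : SmoothVectorField W) (hX : SmoothVectorField X)
    -- `V` is the vector field `P^{dc} α_d`
    (V : Π x : N, TangentSpace (𝓡 𝔫) x) (hV : V = d.raiseField α) (x : N) :
    riem D α W d.n X x =
      α x (d.n x) *
        (covOneForm D d.s W X x - d.s x (X x) * d.s x (W x)
          + d.n2 x * (d.s x (W x) * dScalar d.l2 x (X x) + d.s x (X x) * dScalar d.l2 x (W x))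
          + dScalar d.l2 x (d.n x) * d.U x (W x) (X x)
          + d.P x (d.U x (W x) - d.n2 x • d.F x (W x)) (d.F x (X x))
          - 1 / 2 * dScalar d.n2 x (W x) * dScalar d.l2 x (X x)
          - 1 / 2 * d.n2 x ^ 2 * dScalar d.l2 x (W x) * dScalar d.l2 x (X x))
      + (covTwoTensor D d.U W V X x - covTwoTensor D d.U V W X x
          + 2 * d.s x (V x) * d.U x (W x) (X x) - d.s x (W x) * d.U x (X x) (V x)
          + 1 / 2 * d.F x (V x) (X x) * dScalar d.n2 x (W x)
          + d.n2 x * (- (d.U x (W x) (X x) * dScalar d.l2 x (V x))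
            + d.U x (X x) (V x) * dScalar d.l2 x (W x)
            - covTwoTensor D d.F X V W x
            + d.F x (X x) (V x) * (d.s x (W x) - 1 / 2 * d.n2 x * dScalar d.l2 x (W x)))) := by
  have hVs : SmoothVectorField V := hV ▸ d.raiseField_smooth hα
  have hVx : V x = d.raise x (α x) := by rw [hV]; rfl
  -- Read backwards, the lemma turns the right-hand side into `γ(R(n,X)W, V) + α(n) ℓ(R(n,X)W)`,
  -- which is `α(R(n,X)W)` by the splitting of `α`.
  rw [← hD.γ_curvatureOp_n hVs hW hX x (α x (d.n x)) (by rw [hVx, d.l_raise]), riem, hVx,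
    d.γ_symm x _ (d.raise x (α x)), d.γ_raise_add]
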